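/- Let $n\ge 1$ and let $\mathbb R^{n+1}_+=\{(x,y): x\in\mathbb R^n,\ y>0\}$. Let $u$ be a (real- or complex-valued) harmonic function on $\mathbb R^{n+1}_+$ in the Dirichlet space $\mathcal D(\mathbb R^{n+1}_+)$, that is, $$\sup_{y>0}\left(\int_{\mathbb R^n}|u(x,y)|^2\,dx\right)^{1/2}<\infty\qquad\text{and}\qquad \int_{\mathbb R^{n+1}_+}|\nabla u(x,y)|^2\,dx\,dy<\infty ,$$ and let $f$ be the boundary function of $u$, that is, $\lim_{y\to0^+}u(x,y)=f(x)$ for almost every $x\in\mathbb R^n$. Then $$\int_{\mathbb R^{n+1}_+}|\nabla u(x,y)|^2\,dx\,dy=\frac1{\omega_n}\int_{\mathbb R^n}\int_{\mathbb R^n}\frac{|f(t_1)-f(t_2)|^2}{|t_1-t_2|^{n+1}}\,dt_1\,dt_2,$$ where $\omega_n=2\pi^{(n+1)/2}/\Gamma\!\left(\frac{n+1}{2}\right)$ is the surface area of the unit sphere in $\mathbb R^{n+1}$. In particular, the double integral is finite. -/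

import Mathlib

open MeasureTheory Set Filter Topology
open scoped ENNReal

noncomputable section

namespace HalfSpaceDirichlet

/-- Euclidean space `ℝⁿ⁺¹ = ℝⁿ × ℝ` with points `(x, y)` and the Euclidean (`ℓ²`) norm. -/
abbrev Ambient (n : ℕ) : Type := WithLp 2 (EuclideanSpace ℝ (Fin n) × ℝ)

/-- The point `(x, y)` of `ℝⁿ⁺¹`. -/
abbrev pt {n : ℕ} (x : EuclideanSpace ℝ (Fin n)) (y : ℝ) : Ambient n := WithLp.toLp 2 (x, y)

/-- The open upper half-space `{(x, y) : x ∈ ℝⁿ, y > 0}`. -/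
def upperHalfSpace (n : ℕ) : Set (Ambient n) := {p | 0 < p.snd}

section

variable {𝕜 : Type*} [RCLike 𝕜] {n : ℕ}

/-- `|∇u|² = ∑ⱼ |∂u/∂xⱼ|² + |∂u/∂y|²` at the point `p`. -/
def gradNormSq (u : Ambient n → 𝕜) (p : Ambient n) : ℝ :=
  ∑ j : Fin n, ‖fderiv ℝ u p (pt (EuclideanSpace.single j 1) 0)‖ ^ 2 +
    ‖fderiv ℝ u p (pt 0 1)‖ ^ 2

/-- The Dirichlet energy: the integral of `|∇u|²` over the upper half-space, in `[0, ∞]`. -/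
def dirichletEnergy (u : Ambient n → 𝕜) : ℝ≥0∞ :=
  ∫⁻ p in upperHalfSpace n, ENNReal.ofReal (gradNormSq u p)

/-- The Hardy norm `sup_{y > 0} (∫ |u(x, y)|² dx)^{1/2}`, in `[0, ∞]`. -/
def hardyNorm (u : Ambient n → 𝕜) : ℝ≥0∞ :=
  ⨆ y ∈ Ioi (0 : ℝ), eLpNorm (fun x : EuclideanSpace ℝ (Fin n) => u (pt x y)) 2 volume

/-- Membership in the harmonic Hardy space `h²` of the upper half-space. -/
structure MemHardy (u : Ambient n → 𝕜) : Prop where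
  harmonic : InnerProductSpace.HarmonicOnNhd u (upperHalfSpace n)
  norm_lt_top : hardyNorm u < ∞

/-- Membership in the Dirichlet space of the upper half-space. -/
structure MemDirichlet (u : Ambient n → 𝕜) : Prop where
  memHardy : MemHardy u
  energy_lt_top : dirichletEnergy u < ∞

/-- `f` is a boundary function of `u`: `u(x, y) → f(x)` as `y → 0⁺`, for almost every `x ∈ ℝⁿ`. -/
def IsBoundaryFunction (u : Ambient n → 𝕜) (f : EuclideanSpace ℝ (Fin n) → 𝕜) : Prop :=
  ∀ᵐ x : EuclideanSpace ℝ (Fin n), Tendsto (fun y : ℝ => u (pt x y)) (𝓝[>] 0) (𝓝 (f x))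

/-- The double integral `∬ |f(t₁) - f(t₂)|² / |t₁ - t₂|ⁿ⁺¹ dt₁ dt₂`, in `[0, ∞]`. -/
def doubleIntegral (f : EuclideanSpace ℝ (Fin n) → 𝕜) : ℝ≥0∞ :=
  ∫⁻ t₁ : EuclideanSpace ℝ (Fin n), ∫⁻ t₂ : EuclideanSpace ℝ (Fin n),
    ENNReal.ofReal (‖f t₁ - f t₂‖ ^ 2 / ‖t₁ - t₂‖ ^ (n + 1))

end

/-- `ωₙ = 2 π^{(n+1)/2} / Γ((n+1)/2)`, the surface area of the unit sphere of `ℝⁿ⁺¹`. -/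
def sphereArea (n : ℕ) : ℝ :=
  2 * Real.pi ^ (((n : ℝ) + 1) / 2) / Real.Gamma (((n : ℝ) + 1) / 2)

end HalfSpaceDirichlet

end

noncomputable section

namespace HalfSpaceDirichlet

open scoped SchwartzMap ContDiff

section SchwartzDensity

variable {E : Type*} [NormedAddCommGroup E] [InnerProductSpace ℝ E] [FiniteDimensional ℝ E]

/-- The smooth cutoff at scale `k + 1`, minus one. -/
def cutoffSubOne (E : Type*) [NormedAddCommGroup E] [InnerProductSpace ℝ E]
    [FiniteDimensional ℝ E] (k : ℕ) (x : E) : ℝ :=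
  (⟨1, 2, one_pos, one_lt_two⟩ : ContDiffBump (0 : E)) (((k : ℝ) + 1)⁻¹ • x) - 1

lemma contDiff_cutoffSubOne (k : ℕ) : ContDiff ℝ ∞ (cutoffSubOne E k) := by
  unfold cutoffSubOne
  exact ((ContDiffBump.contDiff _).comp (contDiff_id.const_smul _)).sub contDiff_const

lemma hasCompactSupport_cutoff (k : ℕ) :
    HasCompactSupport (fun x : E => cutoffSubOne E k x + 1) := by
  simp only [cutoffSubOne, sub_add_cancel]
  refine HasCompactSupport.of_support_subset_isCompact
    (isCompact_closedBall (0 : E) (2 * ((k : ℝ) + 1))) fun x hx => ?_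
  have h : ((k : ℝ) + 1)⁻¹ • x ∈ Function.support
      (⟨1, 2, one_pos, one_lt_two⟩ : ContDiffBump (0 : E)) := hx
  rw [ContDiffBump.support_eq, mem_ball_zero_iff, norm_smul, norm_inv, Real.norm_of_nonneg
    (by positivity), inv_mul_lt_iff₀ (by positivity)] at h
  rw [mem_closedBall_zero_iff]
  linarith

lemma norm_iteratedFDeriv_cutoffSubOne_le (i : ℕ) :
    ∃ C : ℝ, 0 ≤ C ∧ ∀ (k : ℕ) (x : E),
      ‖iteratedFDeriv ℝ i (cutoffSubOne E k) x‖ ≤ C * ‖x‖ * ((k : ℝ) + 1)⁻¹ := by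
  set χ : ContDiffBump (0 : E) := ⟨1, 2, one_pos, one_lt_two⟩ with hχ
  set G : E → ℝ := fun x => χ x - 1 with hG
  have hGs : ContDiff ℝ ∞ G := χ.contDiff.sub contDiff_const
  obtain ⟨C, hC⟩ : ∃ C : ℝ, ∀ x, ‖iteratedFDeriv ℝ i G x‖ ≤ C := by
    obtain ⟨C, hC⟩ := (χ.hasCompactSupport.iteratedFDeriv (𝕜 := ℝ) i).exists_bound_of_continuous
      ((χ.contDiff (n := (⊤ : ℕ∞))).continuous_iteratedFDeriv (by exact_mod_cast le_top))
    refine ⟨C + ‖iteratedFDeriv ℝ i (fun _ : E => (1 : ℝ)) 0‖, fun x => ?_⟩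
    have : iteratedFDeriv ℝ i G x
        = iteratedFDeriv ℝ i χ x - iteratedFDeriv ℝ i (fun _ : E => (1 : ℝ)) x := by
      rw [hG]
      exact iteratedFDeriv_sub_apply (χ.contDiff.contDiffAt) contDiffAt_const
    rw [this]
    refine (norm_sub_le _ _).trans (add_le_add (hC x) ?_)
    rcases i with _ | i
    · simp
    · simp [iteratedFDeriv_const_of_ne (𝕜 := ℝ) (Nat.succ_ne_zero i) (1 : ℝ)]
  have hC0 : 0 ≤ C := (norm_nonneg _).trans (hC 0)
  refine ⟨C, hC0, fun k x => ?_⟩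
  set ε : ℝ := ((k : ℝ) + 1)⁻¹ with hε
  have hε0 : 0 < ε := by positivity
  have hε1 : ε ≤ 1 := inv_le_one_of_one_le₀ (by linarith [(Nat.cast_nonneg k : (0 : ℝ) ≤ k)])
  set L : E →L[ℝ] E := ε • ContinuousLinearMap.id ℝ E with hL
  have hcomp : cutoffSubOne E k = G ∘ L := by
    ext x; simp [cutoffSubOne, hG, hL, hχ, hε]
  have hLn : ‖L‖ ≤ 1 := by
    rw [hL, norm_smul, Real.norm_of_nonneg hε0.le]
    exact mul_le_one₀ hε1 (norm_nonneg _) ContinuousLinearMap.norm_id_le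
  by_cases hx : ‖ε • x‖ < 1
  · have : cutoffSubOne E k =ᶠ[𝓝 x] fun _ => 0 := by
      have hcont : Tendsto (fun z : E => ε • z) (𝓝 x) (𝓝 (ε • x)) :=
        (continuous_const_smul ε).tendsto x
      filter_upwards [hcont.eventually (Metric.isOpen_ball.mem_nhds (mem_ball_zero_iff.2 hx))]
        with z hz
      have := χ.one_of_mem_closedBall (Metric.ball_subset_closedBall hz)
      simp only [cutoffSubOne]
      rw [← hε, ← hχ, this, sub_self]
    rw [(this.iteratedFDeriv ℝ i).eq_of_nhds]
    have h0 : iteratedFDeriv ℝ i (fun _ : E => (0 : ℝ)) x = 0 := by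
      simp
    rw [h0, norm_zero]
    positivity
  · rw [hcomp, L.iteratedFDeriv_comp_right hGs x (by exact_mod_cast le_top)]
    refine (ContinuousMultilinearMap.norm_compContinuousLinearMap_le _ _).trans ?_
    rw [norm_smul, Real.norm_of_nonneg hε0.le, not_lt] at hx
    calc _ ≤ C * 1 := by
          refine mul_le_mul (hC _) ?_ (by positivity) hC0
          simpa using pow_le_one₀ (norm_nonneg _) hLn
      _ ≤ C * (ε * ‖x‖) := by gcongr
      _ = C * ‖x‖ * ε := by ring

/-- Compactly supported Schwartz functions are dense in the Schwartz space. -/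
lemma exists_seq_hasCompactSupport_tendsto (f : 𝓢(E, ℂ)) :
    ∃ g : ℕ → 𝓢(E, ℂ), (∀ k, HasCompactSupport (g k)) ∧ Tendsto g atTop (𝓝 f) := by
  have hcs (k : ℕ) : HasCompactSupport (fun x : E => (cutoffSubOne E k x + 1) • f x) :=
    (hasCompactSupport_cutoff k).smul_right
  have hsm (k : ℕ) : ContDiff ℝ ∞ (fun x : E => (cutoffSubOne E k x + 1) • f x) :=
    ((contDiff_cutoffSubOne k).add contDiff_const).smul (f.smooth _)
  refine ⟨fun k => (hcs k).toSchwartzMap (hsm k), fun k => hcs k, ?_⟩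
  rw [(schwartz_withSeminorms ℝ E ℂ).tendsto_nhds _ f]
  rintro ⟨a, b⟩ ε hε
  choose C hC0 hC using norm_iteratedFDeriv_cutoffSubOne_le (E := E)
  set K : ℝ := ∑ i ∈ Finset.range (b + 1),
    (b.choose i : ℝ) * C i * SchwartzMap.seminorm ℝ (a + 1) (b - i) f with hK
  have hbound (k : ℕ) : SchwartzMap.seminorm ℝ a b ((hcs k).toSchwartzMap (hsm k) - f)
      ≤ K * ((k : ℝ) + 1)⁻¹ := by
    refine SchwartzMap.seminorm_le_bound ℝ a b _ (mul_nonneg (Finset.sum_nonneg fun i _ =>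
      mul_nonneg (mul_nonneg (by positivity) (hC0 i)) (apply_nonneg _ _)) (by positivity))
      fun x => ?_
    have heq : (((hcs k).toSchwartzMap (hsm k) - f : 𝓢(E, ℂ)) : E → ℂ)
        = fun x => cutoffSubOne E k x • f x := by
      ext x
      change (cutoffSubOne E k x + 1) • f x - f x = _
      rw [add_smul, one_smul, add_sub_cancel_right]
    rw [heq]
    have h1 := norm_iteratedFDeriv_smul_le (𝕜 := ℝ) (contDiff_cutoffSubOne (E := E) k)
      (f.smooth ⊤) x (n := b) (by exact_mod_cast le_top)
    calc ‖x‖ ^ a * ‖iteratedFDeriv ℝ b (fun x => cutoffSubOne E k x • f x) x‖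
        ≤ ‖x‖ ^ a * ∑ i ∈ Finset.range (b + 1), (b.choose i : ℝ) *
          ‖iteratedFDeriv ℝ i (cutoffSubOne E k) x‖ * ‖iteratedFDeriv ℝ (b - i) f x‖ := by
          gcongr
      _ ≤ ‖x‖ ^ a * ∑ i ∈ Finset.range (b + 1), (b.choose i : ℝ) *
          (C i * ‖x‖ * ((k : ℝ) + 1)⁻¹) * ‖iteratedFDeriv ℝ (b - i) f x‖ := by
          gcongr with i hi; exact hC i k x
      _ = ∑ i ∈ Finset.range (b + 1), (b.choose i : ℝ) * C i *
          (‖x‖ ^ (a + 1) * ‖iteratedFDeriv ℝ (b - i) f x‖) * ((k : ℝ) + 1)⁻¹ := by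
          rw [Finset.mul_sum]
          refine Finset.sum_congr rfl fun i _ => ?_
          ring
      _ ≤ K * ((k : ℝ) + 1)⁻¹ := by
          rw [hK, Finset.sum_mul]
          gcongr with i hi
          · exact mul_nonneg (by positivity) (hC0 i)
          · exact SchwartzMap.le_seminorm ℝ (a + 1) (b - i) f x
  have hlim : Tendsto (fun k : ℕ => K * ((k : ℝ) + 1)⁻¹) atTop (𝓝 0) := by
    have := tendsto_one_div_add_atTop_nhds_zero_nat (𝕜 := ℝ)
    simpa [one_div] using this.const_mul K
  filter_upwards [hlim.eventually (gt_mem_nhds hε)] with k hk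
  exact (hbound k).trans_lt hk

end SchwartzDensity

end HalfSpaceDirichlet

end

noncomputable section

namespace HalfSpaceDirichlet

section Kernel

lemma lintegral_rpow_mul_exp_neg_mul {a r : ℝ} (ha : 0 < a) (hr : 0 < r) :
    ∫⁻ s in Ioi (0 : ℝ), ENNReal.ofReal (s ^ (a - 1) * Real.exp (-(r * s))) =
      ENNReal.ofReal ((1 / r) ^ a * Real.Gamma a) := by
  have h := Real.integral_rpow_mul_exp_neg_mul_Ioi ha hr
  rw [← h, ofReal_integral_eq_lintegral_ofReal]
  · refine Integrable.of_integral_ne_zero ?_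
    rw [h]
    have := Real.Gamma_pos_of_pos ha
    positivity
  · filter_upwards [ae_restrict_mem measurableSet_Ioi] with s hs
    exact mul_nonneg (Real.rpow_nonneg (le_of_lt hs) _) (Real.exp_nonneg _)

lemma lintegral_rpow_mul_exp_neg_div {b : ℝ} (hb : 0 < b) :
    ∫⁻ s in Ioi (0 : ℝ), ENNReal.ofReal (s ^ (-(3 / 2) : ℝ) * Real.exp (-(b / s))) =
      ENNReal.ofReal (√Real.pi * b ^ (-(1 / 2) : ℝ)) := by
  have h1 := Real.integral_rpow_mul_exp_neg_mul_Ioi (a := 1 / 2) (by norm_num) hb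
  have h2 := integral_comp_rpow_Ioi
    (fun t : ℝ => t ^ ((1 / 2 : ℝ) - 1) * Real.exp (-(b * t))) (p := -1) (by norm_num)
  have h3 : ∫ s in Ioi (0 : ℝ), s ^ (-(3 / 2) : ℝ) * Real.exp (-(b / s))
      = √Real.pi * b ^ (-(1 / 2) : ℝ) := by
    rw [h1, Real.Gamma_one_half_eq] at h2
    rw [mul_comm, Real.rpow_neg hb.le, ← Real.inv_rpow hb.le, ← one_div, ← h2]
    refine setIntegral_congr_fun measurableSet_Ioi fun s (hs : 0 < s) => ?_
    simp only [abs_neg, abs_one, one_mul, smul_eq_mul]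
    rw [← Real.rpow_mul hs.le, ← mul_assoc, ← Real.rpow_add hs, Real.rpow_neg_one,
      div_eq_mul_inv b s]
    norm_num
  rw [← h3, ofReal_integral_eq_lintegral_ofReal]
  · refine Integrable.of_integral_ne_zero ?_
    rw [h3]
    have := Real.pi_pos
    positivity
  · filter_upwards [ae_restrict_mem measurableSet_Ioi] with s hs
    exact mul_nonneg (Real.rpow_nonneg (le_of_lt hs) _) (Real.exp_nonneg _)

lemma lintegral_rpow_mul_one_sub_exp {a : ℝ} (ha : 0 ≤ a) :
    ∫⁻ s in Ioi (0 : ℝ), ENNReal.ofReal (s ^ (-(1 / 2) : ℝ) * (1 - Real.exp (-(a / s)))) =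
      ENNReal.ofReal (2 * √Real.pi * √a) := by
  have key (s : ℝ) (hs : 0 < s) :
      ENNReal.ofReal (s ^ (-(1 / 2) : ℝ) * (1 - Real.exp (-(a / s)))) =
        ∫⁻ b in Ioc 0 a, ENNReal.ofReal (s ^ (-(3 / 2) : ℝ) * Real.exp (-(b / s))) := by
    have hd : ∀ b ∈ uIcc 0 a, HasDerivAt
        (fun b => -(s ^ (-(1 / 2) : ℝ) * Real.exp (-(b / s))))
        (s ^ (-(3 / 2) : ℝ) * Real.exp (-(b / s))) b := by
      intro b _
      have h := ((((hasDerivAt_id b).div_const s).neg.exp).const_mul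
        (s ^ (-(1 / 2) : ℝ))).neg
      refine HasDerivAt.congr_deriv h ?_
      have : s ^ (-(3 / 2) : ℝ) = s ^ (-(1 / 2) : ℝ) * s⁻¹ := by
        rw [← Real.rpow_neg_one s, ← Real.rpow_add hs]; norm_num
      rw [this]
      simp only [id, one_div, Pi.neg_apply]
      ring
    have hint := intervalIntegral.integral_eq_sub_of_hasDerivAt hd
      (Continuous.intervalIntegrable (by fun_prop) _ _)
    rw [intervalIntegral.integral_of_le ha] at hint
    rw [← ofReal_integral_eq_lintegral_ofReal]
    · rw [hint]
      congr 1
      simp only [zero_div, neg_zero, Real.exp_zero]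
      ring
    · rw [← IntegrableOn, ← intervalIntegrable_iff_integrableOn_Ioc_of_le ha]
      exact Continuous.intervalIntegrable (by fun_prop) _ _
    · exact ae_of_all _ fun b => mul_nonneg (Real.rpow_nonneg hs.le _) (Real.exp_nonneg _)
  rw [setLIntegral_congr_fun measurableSet_Ioi (fun s hs => key s hs),
    lintegral_lintegral_swap (by fun_prop),
    setLIntegral_congr_fun measurableSet_Ioc (fun b hb => lintegral_rpow_mul_exp_neg_div hb.1)]
  have hI : IntervalIntegrable (fun b : ℝ => √Real.pi * b ^ (-(1 / 2) : ℝ)) volume 0 a :=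
    (intervalIntegral.intervalIntegrable_rpow' (by norm_num)).const_mul _
  rw [← ofReal_integral_eq_lintegral_ofReal]
  · rw [← intervalIntegral.integral_of_le ha, intervalIntegral.integral_const_mul,
      integral_rpow (Or.inl (by norm_num))]
    congr 1
    rw [Real.sqrt_eq_rpow a, Real.zero_rpow (by norm_num)]
    norm_num
    ring
  · rwa [← IntegrableOn, ← intervalIntegrable_iff_integrableOn_Ioc_of_le ha]
  · filter_upwards [ae_restrict_mem measurableSet_Ioc] with b hb
    exact mul_nonneg (Real.sqrt_nonneg _) (Real.rpow_nonneg hb.1.le _)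

variable {n : ℕ}

lemma norm_exp_mul_I_sub_one_sq (θ : ℝ) :
    ‖Complex.exp (θ * Complex.I) - 1‖ ^ 2 = 2 - 2 * Real.cos θ := by
  rw [← Complex.normSq_eq_norm_sq, Complex.normSq_apply]
  simp only [Complex.sub_re, Complex.sub_im, Complex.exp_ofReal_mul_I_re,
    Complex.exp_ofReal_mul_I_im, Complex.one_re, Complex.one_im, sub_zero]
  nlinarith [Real.sin_sq_add_cos_sq θ]

lemma integral_two_mul_re_sub {α : Type*} [MeasurableSpace α] {μ : Measure α} {f g : α → ℂ}
    (hf : Integrable f μ) (hg : Integrable g μ) :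
    Integrable (fun x => 2 * (f x).re - 2 * (g x).re) μ ∧
      ∫ x, (2 * (f x).re - 2 * (g x).re) ∂μ = 2 * (∫ x, f x ∂μ).re - 2 * (∫ x, g x ∂μ).re := by
  have hf' : Integrable (fun x => (f x).re) μ := hf.re
  have hg' : Integrable (fun x => (g x).re) μ := hg.re
  have hfr : ∫ x, (f x).re ∂μ = (∫ x, f x ∂μ).re := integral_re hf
  have hgr : ∫ x, (g x).re ∂μ = (∫ x, g x ∂μ).re := integral_re hg
  refine ⟨(hf'.const_mul 2).sub (hg'.const_mul 2), ?_⟩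
  rw [integral_sub (hf'.const_mul 2) (hg'.const_mul 2), integral_const_mul, integral_const_mul,
    hfr, hgr]

lemma integral_gaussian_mul_cos {s : ℝ} (hs : 0 < s) (ξ : EuclideanSpace ℝ (Fin n)) :
    Integrable (fun h : EuclideanSpace ℝ (Fin n) =>
      (2 - 2 * Real.cos (2 * Real.pi * inner ℝ ξ h)) * Real.exp (-(s * ‖h‖ ^ 2))) ∧
    ∫ h : EuclideanSpace ℝ (Fin n),
      (2 - 2 * Real.cos (2 * Real.pi * inner ℝ ξ h)) * Real.exp (-(s * ‖h‖ ^ 2)) =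
      2 * (Real.pi / s) ^ ((n : ℝ) / 2) * (1 - Real.exp (-(Real.pi ^ 2 * ‖ξ‖ ^ 2 / s))) := by
  have hs' : 0 < (s : ℂ).re := by simpa using hs
  have hcast : ((Real.pi : ℂ) / s) ^ ((n : ℂ) / 2) = (((Real.pi / s) ^ ((n : ℝ) / 2) : ℝ) : ℂ) := by
    rw [Complex.ofReal_cpow (by positivity)]; push_cast; rfl
  have hval (c : ℝ) : Integrable (fun h : EuclideanSpace ℝ (Fin n) =>
      Complex.exp (-(s : ℂ) * ‖h‖ ^ 2 + (2 * Real.pi * c * Complex.I) * (inner ℝ ξ h : ℝ))) ∧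
      ∫ h : EuclideanSpace ℝ (Fin n),
      Complex.exp (-(s : ℂ) * ‖h‖ ^ 2 + (2 * Real.pi * c * Complex.I) * (inner ℝ ξ h : ℝ)) =
      (((Real.pi / s) ^ ((n : ℝ) / 2) *
        Real.exp (-(Real.pi ^ 2 * c ^ 2 * ‖ξ‖ ^ 2 / s)) : ℝ) : ℂ) := by
    refine ⟨GaussianFourier.integrable_cexp_neg_mul_sq_norm_add hs' _ ξ, ?_⟩
    rw [GaussianFourier.integral_cexp_neg_mul_sq_norm_add hs', finrank_euclideanSpace_fin, hcast]
    push_cast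
    congr 2
    have : (s : ℂ) ≠ 0 := by exact_mod_cast hs.ne'
    field_simp
    rw [Complex.I_sq]
    ring
  obtain ⟨hi0, h0⟩ := hval 0
  obtain ⟨hi1, h1⟩ := hval 1
  have hfun : (fun h : EuclideanSpace ℝ (Fin n) =>
      (2 - 2 * Real.cos (2 * Real.pi * inner ℝ ξ h)) * Real.exp (-(s * ‖h‖ ^ 2))) =
      fun h => 2 * (Complex.exp (-(s : ℂ) * ‖h‖ ^ 2 +
        (2 * Real.pi * (0 : ℝ) * Complex.I) * (inner ℝ ξ h : ℝ))).re -
        2 * (Complex.exp (-(s : ℂ) * ‖h‖ ^ 2 +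
        (2 * Real.pi * (1 : ℝ) * Complex.I) * (inner ℝ ξ h : ℝ))).re := by
    ext h
    have e0 : -(s : ℂ) * ‖h‖ ^ 2 + (2 * Real.pi * (0 : ℝ) * Complex.I) * (inner ℝ ξ h : ℝ) =
      ((-(s * ‖h‖ ^ 2) : ℝ) : ℂ) := by push_cast; ring
    have e1 : -(s : ℂ) * ‖h‖ ^ 2 + (2 * Real.pi * (1 : ℝ) * Complex.I) * (inner ℝ ξ h : ℝ) =
      ((-(s * ‖h‖ ^ 2) : ℝ) : ℂ) + ((2 * Real.pi * inner ℝ ξ h : ℝ) : ℂ) * Complex.I := by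
      push_cast; ring
    rw [e0, e1, Complex.exp_add, ← Complex.ofReal_exp, Complex.re_ofReal_mul,
      Complex.exp_ofReal_mul_I_re, Complex.ofReal_re]
    ring
  rw [hfun]
  obtain ⟨ha, hb⟩ := integral_two_mul_re_sub hi0 hi1
  refine ⟨ha, ?_⟩
  rw [hb, h0, h1, Complex.ofReal_re, Complex.ofReal_re]
  simp
  ring

lemma ofReal_div_norm_pow_eq_lintegral (h : EuclideanSpace ℝ (Fin n)) (hne : h ≠ 0) (c : ℝ)
    (hc : 0 ≤ c) :
    ENNReal.ofReal (c / ‖h‖ ^ (n + 1)) =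
      ENNReal.ofReal (1 / Real.Gamma (((n : ℝ) + 1) / 2)) *
      ∫⁻ s in Ioi (0 : ℝ), ENNReal.ofReal
        (s ^ (((n : ℝ) + 1) / 2 - 1) * (c * Real.exp (-(s * ‖h‖ ^ 2)))) := by
  have hG : 0 < Real.Gamma (((n : ℝ) + 1) / 2) := Real.Gamma_pos_of_pos (by positivity)
  have hn0 : 0 < ‖h‖ := norm_pos_iff.2 hne
  have : ∀ s ∈ Ioi (0 : ℝ), ENNReal.ofReal
        (s ^ (((n : ℝ) + 1) / 2 - 1) * (c * Real.exp (-(s * ‖h‖ ^ 2)))) =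
      ENNReal.ofReal c * ENNReal.ofReal
        (s ^ (((n : ℝ) + 1) / 2 - 1) * Real.exp (-(‖h‖ ^ 2 * s))) := by
    intro s _
    rw [← ENNReal.ofReal_mul hc]
    congr 1
    rw [mul_comm s]; ring
  rw [setLIntegral_congr_fun measurableSet_Ioi this, lintegral_const_mul' _ _ ENNReal.ofReal_ne_top,
    lintegral_rpow_mul_exp_neg_mul (by positivity) (by positivity), ← ENNReal.ofReal_mul hc,
    ← ENNReal.ofReal_mul (by positivity)]
  congr 1
  have hp : (1 / ‖h‖ ^ 2) ^ (((n : ℝ) + 1) / 2) = 1 / ‖h‖ ^ (n + 1) := by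
    rw [Real.div_rpow zero_le_one (by positivity), Real.one_rpow, ← Real.rpow_natCast ‖h‖ 2,
      ← Real.rpow_mul hn0.le, ← Real.rpow_natCast ‖h‖ (n + 1)]
    congr 2
    push_cast; ring
  rw [hp]
  field_simp

/-- The Fourier symbol of the double integral. -/
theorem lintegral_norm_exp_sub_one_sq_div (ξ : EuclideanSpace ℝ (Fin n)) :
    ∫⁻ h : EuclideanSpace ℝ (Fin n), ENNReal.ofReal
      (‖Complex.exp ((2 * Real.pi * inner ℝ ξ h : ℝ) * Complex.I) - 1‖ ^ 2 / ‖h‖ ^ (n + 1)) =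
      ENNReal.ofReal (sphereArea n * (2 * Real.pi * ‖ξ‖)) := by
  have hG : 0 < Real.Gamma (((n : ℝ) + 1) / 2) := Real.Gamma_pos_of_pos (by positivity)
  have hcos (h : EuclideanSpace ℝ (Fin n)) : 0 ≤ 2 - 2 * Real.cos (2 * Real.pi * inner ℝ ξ h) := by
    linarith [Real.cos_le_one (2 * Real.pi * inner ℝ ξ h)]
  have h1 (h : EuclideanSpace ℝ (Fin n)) : ENNReal.ofReal
      (‖Complex.exp ((2 * Real.pi * inner ℝ ξ h : ℝ) * Complex.I) - 1‖ ^ 2 / ‖h‖ ^ (n + 1)) =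
      ENNReal.ofReal (1 / Real.Gamma (((n : ℝ) + 1) / 2)) *
      ∫⁻ s in Ioi (0 : ℝ), ENNReal.ofReal (s ^ (((n : ℝ) + 1) / 2 - 1) *
        ((2 - 2 * Real.cos (2 * Real.pi * inner ℝ ξ h)) * Real.exp (-(s * ‖h‖ ^ 2)))) := by
    rw [norm_exp_mul_I_sub_one_sq]
    by_cases hne : h = 0
    · simp [hne]
    · exact ofReal_div_norm_pow_eq_lintegral h hne _ (hcos h)
  have h2 (s : ℝ) (hs : s ∈ Ioi (0 : ℝ)) : ∫⁻ h : EuclideanSpace ℝ (Fin n),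
      ENNReal.ofReal (s ^ (((n : ℝ) + 1) / 2 - 1) *
        ((2 - 2 * Real.cos (2 * Real.pi * inner ℝ ξ h)) * Real.exp (-(s * ‖h‖ ^ 2)))) =
      ENNReal.ofReal (2 * Real.pi ^ ((n : ℝ) / 2)) * ENNReal.ofReal
        (s ^ (-(1 / 2) : ℝ) * (1 - Real.exp (-(Real.pi ^ 2 * ‖ξ‖ ^ 2 / s)))) := by
    have hs0 : 0 < s := hs
    obtain ⟨hi, hv⟩ := integral_gaussian_mul_cos (n := n) hs0 ξ
    rw [← ofReal_integral_eq_lintegral_ofReal (hi.const_mul _), integral_const_mul, hv,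
      ← ENNReal.ofReal_mul (by positivity)]
    · congr 1
      have : s ^ (-(1 / 2) : ℝ) * s ^ ((n : ℝ) / 2) = s ^ (((n : ℝ) + 1) / 2 - 1) := by
        rw [← Real.rpow_add hs0]; congr 1; ring
      rw [Real.div_rpow Real.pi_pos.le hs0.le, ← this]
      have := (Real.rpow_pos_of_pos hs0 ((n : ℝ) / 2)).ne'
      field_simp
    · exact ae_of_all _ fun h => mul_nonneg (Real.rpow_nonneg hs0.le _)
        (mul_nonneg (hcos h) (Real.exp_nonneg _))
  simp_rw [h1]
  rw [lintegral_const_mul' _ _ ENNReal.ofReal_ne_top, lintegral_lintegral_swap (by fun_prop),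
    setLIntegral_congr_fun measurableSet_Ioi h2, lintegral_const_mul' _ _ ENNReal.ofReal_ne_top,
    lintegral_rpow_mul_one_sub_exp (by positivity), ← ENNReal.ofReal_mul (by positivity),
    ← ENNReal.ofReal_mul (by positivity)]
  congr 1
  rw [Real.sqrt_mul (by positivity), Real.sqrt_sq Real.pi_pos.le, Real.sqrt_sq (norm_nonneg _),
    sphereArea, Real.sqrt_eq_rpow, add_div, Real.rpow_add Real.pi_pos]
  field_simp

end Kernel

end HalfSpaceDirichlet

end

noncomputable section

namespace HalfSpaceDirichlet

open scoped SchwartzMap ContDiff FourierTransform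

section SquareIntegrable

lemma eLpNorm_two_sq {α F : Type*} [MeasurableSpace α] {μ : Measure α} [NormedAddCommGroup F]
    (f : α → F) : eLpNorm f 2 μ ^ 2 = ∫⁻ x, ‖f x‖ₑ ^ 2 ∂μ := by
  rw [eLpNorm_eq_lintegral_rpow_enorm_toReal two_ne_zero ENNReal.ofNat_ne_top,
    ← ENNReal.rpow_natCast, ← ENNReal.rpow_mul]
  simp

lemma memLp_two_of_lintegral_lt_top {α F : Type*} [MeasurableSpace α] {μ : Measure α}
    [NormedAddCommGroup F] {f : α → F} (hf : AEStronglyMeasurable f μ)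
    (h : ∫⁻ x, ‖f x‖ₑ ^ 2 ∂μ < ⊤) : MemLp f 2 μ := by
  refine ⟨hf, ?_⟩
  rw [← eLpNorm_two_sq] at h
  by_contra hc
  rw [not_lt, top_le_iff] at hc
  simp [hc] at h

/-- Dominated convergence in `L²`. -/
lemma tendsto_eLpNorm_sub_of_dominated {α F : Type*} [MeasurableSpace α] {μ : Measure α}
    [NormedAddCommGroup F] {f : ℕ → α → F} {g : α → F} {B : α → ℝ}
    (hf : ∀ k, AEStronglyMeasurable (f k) μ) (hB : MemLp B 2 μ)
    (hb : ∀ k, ∀ᵐ x ∂μ, ‖f k x‖ ≤ B x)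
    (hg : ∀ᵐ x ∂μ, Tendsto (fun k => f k x) atTop (𝓝 (g x))) :
    MemLp g 2 μ ∧ Tendsto (fun k => eLpNorm (f k - g) 2 μ) atTop (𝓝 0) := by
  have hgm : AEStronglyMeasurable g μ := aestronglyMeasurable_of_tendsto_ae atTop hf hg
  have hgB : ∀ᵐ x ∂μ, ‖g x‖ ≤ B x := by
    filter_upwards [ae_all_iff.2 hb, hg] with x h1 h2
    exact le_of_tendsto h2.norm (Eventually.of_forall h1)
  refine ⟨hB.mono' hgm hgB, ?_⟩
  have hsq : Tendsto (fun k => ∫⁻ x, ‖f k x - g x‖ₑ ^ 2 ∂μ) atTop (𝓝 (∫⁻ _, 0 ∂μ)) := by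
    refine tendsto_lintegral_of_dominated_convergence' (fun x => ‖2 * B x‖ₑ ^ 2)
      (fun k => (((hf k).sub hgm).enorm.pow_const 2)) (fun k => ?_) ?_ ?_
    · filter_upwards [hb k, hgB] with x h1 h2
      gcongr
      rw [enorm_le_iff_norm_le]
      refine (norm_sub_le _ _).trans ?_
      rw [Real.norm_of_nonneg (by linarith [norm_nonneg (g x)])]
      linarith
    · rw [← eLpNorm_two_sq]
      exact (ENNReal.pow_lt_top (hB.const_mul 2).2).ne
    · filter_upwards [hg] with x hx
      have : Tendsto (fun k => f k x - g x) atTop (𝓝 0) := by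
        simpa using hx.sub_const (g x)
      simpa [Function.comp_def] using ((ENNReal.continuous_pow 2).tendsto _).comp this.enorm
  have h2 (k : ℕ) : eLpNorm (f k - g) 2 μ = (∫⁻ x, ‖f k x - g x‖ₑ ^ 2 ∂μ) ^ (1 / 2 : ℝ) := by
    rw [show (∫⁻ x, ‖f k x - g x‖ₑ ^ 2 ∂μ) = eLpNorm (f k - g) 2 μ ^ 2 from
      (eLpNorm_two_sq _).symm, ← ENNReal.rpow_natCast, ← ENNReal.rpow_mul]
    simp
  simp_rw [h2]
  rw [lintegral_zero] at hsq
  simpa [Function.comp_def] using (ENNReal.continuous_rpow_const (y := (1 / 2 : ℝ))).tendsto 0 |>.comp hsq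

variable {E : Type*} [NormedAddCommGroup E] [InnerProductSpace ℝ E] [FiniteDimensional ℝ E]
  [MeasurableSpace E] [BorelSpace E]

/-- The space `L²(E; ℂ)`. -/
abbrev L2 (E : Type*) [NormedAddCommGroup E] [InnerProductSpace ℝ E] [FiniteDimensional ℝ E]
    [MeasurableSpace E] [BorelSpace E] : Type _ := Lp ℂ 2 (volume : Measure E)

lemma lintegral_fourier_sq (g : L2 E) :
    ∫⁻ ξ, ‖(𝓕 g : L2 E) ξ‖ₑ ^ 2 = ∫⁻ x, ‖g x‖ₑ ^ 2 := by
  rw [← eLpNorm_two_sq, ← eLpNorm_two_sq, ← Lp.enorm_def, ← Lp.enorm_def, ← ofReal_norm,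
    ← ofReal_norm, Lp.norm_fourier_eq]

lemma integral_mul_fourier (g : L2 E) (ψ : 𝓢(E, ℂ)) :
    ∫ ξ, ψ ξ * (𝓕 g : L2 E) ξ = ∫ x, (𝓕 ψ : 𝓢(E, ℂ)) x * g x := by
  have h := congrArg (fun T : 𝓢'(E, ℂ) => T ψ) (Lp.fourier_toTemperedDistribution_eq g)
  simpa [TemperedDistribution.fourier_apply] using h.symm

/-- If `gₖ → g` almost everywhere while `𝓕 gₖ → G` almost everywhere, dominated by a
square-integrable function, then `𝓕 g = G`. -/
lemma exists_fourier_eq_of_tendsto {g : ℕ → L2 E} {g₀ G : E → ℂ} {B : E → ℝ}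
    (hB : MemLp B 2 volume) (hb : ∀ k, ∀ᵐ ξ : E, ‖(𝓕 (g k) : L2 E) ξ‖ ≤ B ξ)
    (hG : ∀ᵐ ξ : E, Tendsto (fun k => (𝓕 (g k) : L2 E) ξ) atTop (𝓝 (G ξ)))
    (hg : ∀ᵐ x : E, Tendsto (fun k => g k x) atTop (𝓝 (g₀ x))) :
    ∃ w : L2 E, w =ᵐ[volume] g₀ ∧ (𝓕 w : L2 E) =ᵐ[volume] G := by
  obtain ⟨hGm, hlim⟩ := tendsto_eLpNorm_sub_of_dominated
    (fun k => Lp.aestronglyMeasurable (𝓕 (g k) : L2 E)) hB hb hG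
  set W : L2 E := hGm.toLp G
  have h1 : Tendsto (fun k => (𝓕 (g k) : L2 E)) atTop (𝓝 W) := by
    rw [Lp.tendsto_Lp_iff_tendsto_eLpNorm']
    refine hlim.congr fun k => eLpNorm_congr_ae ?_
    filter_upwards [hGm.coeFn_toLp] with x hx
    simp only [Pi.sub_apply]
    rw [hx]
  have h2 : Tendsto g atTop (𝓝 (𝓕⁻ W)) := by
    have := ((FourierTransform.continuous_fourierInv (E := L2 E)
      (F := L2 E)).tendsto W).comp h1
    simpa [Function.comp_def] using this
  rw [Lp.tendsto_Lp_iff_tendsto_eLpNorm'] at h2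
  obtain ⟨ns, hns, hae⟩ := (tendstoInMeasure_of_tendsto_eLpNorm two_ne_zero
    (fun k => Lp.aestronglyMeasurable (g k)) (Lp.aestronglyMeasurable (𝓕⁻ W))
    h2).exists_seq_tendsto_ae
  refine ⟨𝓕⁻ W, ?_, ?_⟩
  · filter_upwards [hae, hg] with x hx hx'
    exact tendsto_nhds_unique hx (hx'.comp hns.tendsto_atTop)
  · rw [FourierTransform.fourier_fourierInv_eq]
    exact hGm.coeFn_toLp

/-- The Fourier transform of a translate. -/
lemma fourier_translate_ae_eq (g w : L2 E) (a : E)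
    (hw : w =ᵐ[volume] fun x => g (x + a)) :
    (𝓕 w : L2 E) =ᵐ[volume] fun ξ =>
      Complex.exp ((2 * Real.pi * inner ℝ ξ a : ℝ) * Complex.I) * (𝓕 g : L2 E) ξ := by
  set e : E → ℂ := fun ξ => Complex.exp ((2 * Real.pi * inner ℝ ξ a : ℝ) * Complex.I) with he
  have hec : ContDiff ℝ ∞ e := by
    have : ContDiff ℝ ∞ fun ξ : E => (((2 * Real.pi * inner ℝ ξ a : ℝ)) : ℂ) :=
      Complex.ofRealCLM.contDiff.comp (contDiff_const.mul (contDiff_id.inner ℝ contDiff_const))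
    exact (this.mul contDiff_const).cexp
  have hen (ξ : E) : ‖e ξ‖ = 1 := Complex.norm_exp_ofReal_mul_I _
  have hmem : MemLp (fun ξ => e ξ * (𝓕 g : L2 E) ξ) 2 volume := by
    have h1 : MemLp (fun ξ => (𝓕 g : L2 E) ξ) 2 volume := Lp.memLp _
    refine h1.of_le (hec.continuous.aestronglyMeasurable.mul h1.1) (ae_of_all _ fun ξ => ?_)
    rw [norm_mul, hen, one_mul]
  refine ae_eq_of_integral_contDiff_smul_eq
    ((Lp.memLp (𝓕 w : L2 E)).locallyIntegrable one_le_two)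
    (hmem.locallyIntegrable one_le_two) fun ψ hψ hψc => ?_
  have hs1 : HasCompactSupport (fun ξ => (ψ ξ : ℂ)) :=
    hψc.comp_left (g := fun r : ℝ => (r : ℂ)) Complex.ofReal_zero
  have hs2 : HasCompactSupport (fun ξ => (ψ ξ : ℂ) * e ξ) := hs1.mul_right
  have hc1 : ContDiff ℝ ∞ (fun ξ => (ψ ξ : ℂ)) := Complex.ofRealCLM.contDiff.comp hψ
  have hc2 : ContDiff ℝ ∞ (fun ξ => (ψ ξ : ℂ) * e ξ) := hc1.mul hec
  set ψ₁ : 𝓢(E, ℂ) := hs1.toSchwartzMap hc1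
  set ψ₂ : 𝓢(E, ℂ) := hs2.toSchwartzMap hc2
  have hF (x : E) : (𝓕 ψ₂ : 𝓢(E, ℂ)) (x + a) = (𝓕 ψ₁ : 𝓢(E, ℂ)) x := by
    rw [SchwartzMap.fourier_coe, SchwartzMap.fourier_coe, Real.fourier_eq', Real.fourier_eq']
    refine integral_congr_ae (ae_of_all _ fun ξ => ?_)
    change _ • ((ψ ξ : ℂ) * e ξ) = _ • (ψ ξ : ℂ)
    simp only [he, smul_eq_mul]
    rw [mul_left_comm, ← Complex.exp_add, mul_comm]
    congr 2
    rw [inner_add_right]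
    push_cast
    ring
  have h1 : ∫ ξ, ψ ξ • (𝓕 w : L2 E) ξ = ∫ x, (𝓕 ψ₁ : 𝓢(E, ℂ)) x * w x := by
    rw [← integral_mul_fourier]; rfl
  have h2 : ∫ ξ, ψ ξ • (e ξ * (𝓕 g : L2 E) ξ) =
      ∫ x, (𝓕 ψ₂ : 𝓢(E, ℂ)) x * g x := by
    rw [← integral_mul_fourier]
    refine integral_congr_ae (ae_of_all _ fun ξ => ?_)
    change (ψ ξ : ℂ) * (e ξ * _) = ((ψ ξ : ℂ) * e ξ) * _
    ring
  rw [h1, h2, ← integral_add_right_eq_self (fun x => (𝓕 ψ₂ : 𝓢(E, ℂ)) x * g x) a]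
  refine integral_congr_ae ?_
  filter_upwards [hw] with x hx
  rw [hx, hF]

end SquareIntegrable

end HalfSpaceDirichlet

end

noncomputable section

namespace HalfSpaceDirichlet

open scoped SchwartzMap ContDiff FourierTransform LineDeriv Laplacian

section Slices

variable {n : ℕ}

lemma continuous_pt : Continuous fun p : EuclideanSpace ℝ (Fin n) × ℝ => pt p.1 p.2 :=
  WithLp.prod_continuous_toLp 2 _ _

lemma isOpen_upperHalfSpace : IsOpen (upperHalfSpace n) :=
  isOpen_lt continuous_const (WithLp.prod_continuous_ofLp 2 _ _).snd

lemma pt_mem_upperHalfSpace {x : EuclideanSpace ℝ (Fin n)} {y : ℝ} :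
    pt x y ∈ upperHalfSpace n ↔ 0 < y := Iff.rfl

lemma hasFDerivAt_pt_left (x : EuclideanSpace ℝ (Fin n)) (y : ℝ) :
    HasFDerivAt (fun x => pt x y)
      ((WithLp.prodContinuousLinearEquiv 2 ℝ (EuclideanSpace ℝ (Fin n)) ℝ).symm.toContinuousLinearMap
        ∘L ContinuousLinearMap.inl ℝ (EuclideanSpace ℝ (Fin n)) ℝ) x := by
  have h := ((WithLp.prodContinuousLinearEquiv 2 ℝ (EuclideanSpace ℝ (Fin n))
    ℝ).symm.toContinuousLinearMap ∘L ContinuousLinearMap.inl ℝ (EuclideanSpace ℝ (Fin n))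
    ℝ).hasFDerivAt (x := x) |>.add_const (pt 0 y)
  refine h.congr_of_eventuallyEq (Eventually.of_forall fun z => ?_)
  change pt z y = pt z 0 + pt 0 y
  rw [← WithLp.toLp_add]
  simp

lemma hasFDerivAt_pt_right (x : EuclideanSpace ℝ (Fin n)) (y : ℝ) :
    HasFDerivAt (fun y => pt x y)
      ((WithLp.prodContinuousLinearEquiv 2 ℝ (EuclideanSpace ℝ (Fin n)) ℝ).symm.toContinuousLinearMap
        ∘L ContinuousLinearMap.inr ℝ (EuclideanSpace ℝ (Fin n)) ℝ) y := by
  have h := ((WithLp.prodContinuousLinearEquiv 2 ℝ (EuclideanSpace ℝ (Fin n))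
    ℝ).symm.toContinuousLinearMap ∘L ContinuousLinearMap.inr ℝ (EuclideanSpace ℝ (Fin n))
    ℝ).hasFDerivAt (x := y) |>.add_const (pt x 0)
  refine h.congr_of_eventuallyEq (Eventually.of_forall fun z => ?_)
  change pt x z = pt 0 z + pt x 0
  rw [← WithLp.toLp_add]
  simp

lemma fderiv_slice {F : Type*} [NormedAddCommGroup F] [NormedSpace ℝ F] {w : Ambient n → F}
    {x : EuclideanSpace ℝ (Fin n)} {y : ℝ} (hw : DifferentiableAt ℝ w (pt x y)) :
    DifferentiableAt ℝ (fun x => w (pt x y)) x ∧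
    ∀ a, fderiv ℝ (fun x => w (pt x y)) x a = fderiv ℝ w (pt x y) (pt a 0) := by
  have h := hw.hasFDerivAt.comp x (hasFDerivAt_pt_left x y)
  refine ⟨h.differentiableAt, fun a => ?_⟩
  change fderiv ℝ (w ∘ fun x => pt x y) x a = _
  rw [h.fderiv]
  rfl

lemma hasDerivAt_slice {F : Type*} [NormedAddCommGroup F] [NormedSpace ℝ F] {w : Ambient n → F}
    {x : EuclideanSpace ℝ (Fin n)} {y : ℝ} (hw : DifferentiableAt ℝ w (pt x y)) :
    HasDerivAt (fun y => w (pt x y)) (fderiv ℝ w (pt x y) (pt 0 1)) y :=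
  (hw.hasFDerivAt.comp y (hasFDerivAt_pt_right x y)).hasDerivAt

lemma continuous_slice {F : Type*} [TopologicalSpace F] {w : Ambient n → F}
    (hw : ContinuousOn w (upperHalfSpace n)) {y : ℝ} (hy : 0 < y) :
    Continuous fun x : EuclideanSpace ℝ (Fin n) => w (pt x y) :=
  hw.comp_continuous (continuous_pt.comp (.prodMk_left y)) fun _ => hy

/-- Differentiation of `∫ w(x, y) φ(x) dx` with respect to `y`. -/
lemma hasDerivAt_integral_slice_mul {w : Ambient n → ℂ}
    (hw : ContDiffOn ℝ 1 w (upperHalfSpace n)) {φ : EuclideanSpace ℝ (Fin n) → ℂ}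
    (hφ : Continuous φ) (hφc : HasCompactSupport φ) {y : ℝ} (hy : 0 < y) :
    HasDerivAt (fun y => ∫ x, w (pt x y) * φ x)
      (∫ x, fderiv ℝ w (pt x y) (pt 0 1) * φ x) y := by
  have hd : ∀ p ∈ upperHalfSpace n, DifferentiableAt ℝ w p := fun p hp =>
    (hw.contDiffAt (isOpen_upperHalfSpace.mem_nhds hp)).differentiableAt one_ne_zero
  have hc' : ContinuousOn (fun p => fderiv ℝ w p (pt 0 1)) (upperHalfSpace n) :=
    (hw.continuousOn_fderiv_of_isOpen isOpen_upperHalfSpace le_rfl).clm_apply continuousOn_const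
  have hint {w' : Ambient n → ℂ} (hw' : ContinuousOn w' (upperHalfSpace n)) {t : ℝ} (ht : 0 < t) :
      Integrable (fun x => w' (pt x t) * φ x) :=
    ((continuous_slice hw' ht).mul hφ).integrable_of_hasCompactSupport hφc.mul_left
  set K : Set (Ambient n) :=
    (fun p : EuclideanSpace ℝ (Fin n) × ℝ => pt p.1 p.2) '' (tsupport φ ×ˢ Icc (y / 2) (2 * y))
  have hK : IsCompact K := (hφc.isCompact.prod isCompact_Icc).image continuous_pt
  have hKs : K ⊆ upperHalfSpace n := by
    rintro _ ⟨⟨x, t⟩, ⟨_, ht⟩, rfl⟩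
    exact (half_pos hy).trans_le ht.1
  obtain ⟨C, hC⟩ := hK.exists_bound_of_continuousOn (hc'.mono hKs)
  refine (hasDerivAt_integral_of_dominated_loc_of_deriv_le (s := Ioo (y / 2) (2 * y))
    (F' := fun t x => fderiv ℝ w (pt x t) (pt 0 1) * φ x) (bound := fun x => C * ‖φ x‖) (Ioo_mem_nhds (half_lt_self hy) (show y < 2 * y by linarith)) ?_
    (hint hw.continuousOn hy)
    (hint hc' hy).aestronglyMeasurable (ae_of_all _ fun x t ht => ?_)
    ((hφ.integrable_of_hasCompactSupport hφc).norm.const_mul C)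
    (ae_of_all _ fun x t ht => ?_)).2
  · filter_upwards [lt_mem_nhds hy] with t ht
    exact (hint hw.continuousOn ht).aestronglyMeasurable
  · by_cases hx : x ∈ tsupport φ
    · rw [norm_mul]
      exact mul_le_mul_of_nonneg_right
        (hC _ ⟨(x, t), ⟨hx, Ioo_subset_Icc_self ht⟩, rfl⟩) (norm_nonneg _)
    · simp [image_eq_zero_of_notMem_tsupport hx]
  · exact (hasDerivAt_slice (hd _ ((half_pos hy).trans ht.1))).mul_const _

lemma integral_fderiv_slice_mul {w : Ambient n → ℂ}
    (hw : ContDiffOn ℝ 1 w (upperHalfSpace n)) (φ : 𝓢(EuclideanSpace ℝ (Fin n), ℂ))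
    (hφc : HasCompactSupport φ) {y : ℝ} (hy : 0 < y) (a : EuclideanSpace ℝ (Fin n)) :
    ∫ x, fderiv ℝ w (pt x y) (pt a 0) * φ x = -∫ x, w (pt x y) * (∂_{a} φ) x := by
  have hd : ∀ p ∈ upperHalfSpace n, DifferentiableAt ℝ w p := fun p hp =>
    (hw.contDiffAt (isOpen_upperHalfSpace.mem_nhds hp)).differentiableAt one_ne_zero
  have hc' : ContinuousOn (fun p => fderiv ℝ w p (pt a 0)) (upperHalfSpace n) :=
    (hw.continuousOn_fderiv_of_isOpen isOpen_upperHalfSpace le_rfl).clm_apply continuousOn_const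
  have hs (x : EuclideanSpace ℝ (Fin n)) :
      fderiv ℝ w (pt x y) (pt a 0) = fderiv ℝ (fun x => w (pt x y)) x a :=
    ((fderiv_slice (hd _ hy)).2 a).symm
  have hc1 : Continuous fun x => fderiv ℝ (fun x => w (pt x y)) x a := by
    simp_rw [← hs]
    exact continuous_slice hc' hy
  have hcw := continuous_slice hw.continuousOn hy
  have hφ' : HasCompactSupport (∂_{a} φ : 𝓢(EuclideanSpace ℝ (Fin n), ℂ)) :=
    hφc.of_isClosed_subset (isClosed_tsupport _) (SchwartzMap.tsupport_lineDerivOp_subset a φ)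
  simp_rw [hs, SchwartzMap.lineDerivOp_apply_eq_fderiv]
  rw [integral_mul_fderiv_eq_neg_fderiv_mul_of_integrable
    ((hc1.mul φ.continuous).integrable_of_hasCompactSupport hφc.mul_left)
    ((hcw.mul (∂_{a} φ).continuous).integrable_of_hasCompactSupport hφ'.mul_left)
    ((hcw.mul φ.continuous).integrable_of_hasCompactSupport hφc.mul_left)
    (fun x _ => (fderiv_slice (hd _ hy)).1) (fun x _ => φ.differentiableAt), neg_neg]

lemma hasCompactSupport_laplacian {E : Type*} [NormedAddCommGroup E] [InnerProductSpace ℝ E]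
    [FiniteDimensional ℝ E] {φ : 𝓢(E, ℂ)} (hφ : HasCompactSupport φ) :
    HasCompactSupport (Δ φ : 𝓢(E, ℂ)) := by
  rw [SchwartzMap.laplacian_eq_sum (stdOrthonormalBasis ℝ E)]
  refine HasCompactSupport.intro' hφ.isCompact (isClosed_tsupport _) fun x hx => ?_
  rw [_root_.sum_apply]
  refine Finset.sum_eq_zero fun i _ => image_eq_zero_of_notMem_tsupport fun hx' => hx ?_
  exact SchwartzMap.tsupport_lineDerivOp_subset _ _ (SchwartzMap.tsupport_lineDerivOp_subset _ _ hx')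

variable {v : Ambient n → ℂ}

lemma contDiffOn_fderiv_apply (hv : InnerProductSpace.HarmonicOnNhd v (upperHalfSpace n))
    (a : Ambient n) : ContDiffOn ℝ 1 (fun p => fderiv ℝ v p a) (upperHalfSpace n) :=
  (hv.contDiffOn.fderiv_of_isOpen isOpen_upperHalfSpace (by norm_num)).clm_apply contDiffOn_const

lemma fderiv_fderiv_eq_neg_sum (hv : InnerProductSpace.HarmonicOnNhd v (upperHalfSpace n))
    {p : Ambient n} (hp : p ∈ upperHalfSpace n) :
    fderiv ℝ (fun p => fderiv ℝ v p (pt 0 1)) p (pt 0 1) =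
      -∑ j : Fin n, fderiv ℝ (fun p => fderiv ℝ v p (pt (EuclideanSpace.basisFun (Fin n) ℝ j) 0)) p
        (pt (EuclideanSpace.basisFun (Fin n) ℝ j) 0) := by
  have h0 : (Δ v) p = 0 := (hv p hp).2.eq_of_nhds
  have hd : DifferentiableAt ℝ (fderiv ℝ v) p :=
    ((hv.contDiffOn.fderiv_of_isOpen isOpen_upperHalfSpace (m := 1) (by norm_num)).contDiffAt
      (isOpen_upperHalfSpace.mem_nhds hp)).differentiableAt one_ne_zero
  have hap (a : Ambient n) : fderiv ℝ (fun p => fderiv ℝ v p a) p a =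
      iteratedFDeriv ℝ 2 v p ![a, a] := by
    rw [iteratedFDeriv_two_apply, fderiv_clm_apply hd (differentiableAt_const a)]
    simp
  rw [InnerProductSpace.laplacian_eq_iteratedFDeriv_orthonormalBasis v
    ((EuclideanSpace.basisFun (Fin n) ℝ).prod (OrthonormalBasis.singleton Unit ℝ))] at h0
  simp only [Fintype.sum_sum_type, OrthonormalBasis.prod_apply, Sum.elim_inl, Sum.elim_inr,
    Function.comp_apply, Finset.univ_unique, Finset.sum_singleton] at h0
  rw [hap]
  simp_rw [hap]
  rw [eq_neg_iff_add_eq_zero, add_comm]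
  simpa using h0

/-- For a harmonic function `v`, `∂²/∂y² ∫ v(x, y) φ(x) dx = -∫ v(x, y) Δφ(x) dx`. -/
lemma hasDerivAt_integral_deriv_slice (hv : InnerProductSpace.HarmonicOnNhd v (upperHalfSpace n))
    (φ : 𝓢(EuclideanSpace ℝ (Fin n), ℂ)) (hφc : HasCompactSupport φ) {y : ℝ} (hy : 0 < y) :
    HasDerivAt (fun y => ∫ x, fderiv ℝ v (pt x y) (pt 0 1) * φ x)
      (∫ x, v (pt x y) * (-Δ φ) x) y := by
  refine (hasDerivAt_integral_slice_mul (contDiffOn_fderiv_apply hv _) φ.continuous hφc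
    hy).congr_deriv ?_
  set b := EuclideanSpace.basisFun (Fin n) ℝ with hb
  have hv1 : ContDiffOn ℝ 1 v (upperHalfSpace n) := hv.contDiffOn.of_le (by norm_num)
  have hcs (a : EuclideanSpace ℝ (Fin n)) {φ : 𝓢(EuclideanSpace ℝ (Fin n), ℂ)}
      (hφ : HasCompactSupport φ) :
      HasCompactSupport (∂_{a} φ : 𝓢(EuclideanSpace ℝ (Fin n), ℂ)) :=
    hφ.of_isClosed_subset (isClosed_tsupport _) (SchwartzMap.tsupport_lineDerivOp_subset a φ)
  have hj (j : Fin n) : ∫ x, fderiv ℝ (fun p => fderiv ℝ v p (pt (b j) 0)) (pt x y)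
      (pt (b j) 0) * φ x = ∫ x, v (pt x y) * (∂_{b j} (∂_{b j} φ)) x := by
    rw [integral_fderiv_slice_mul (contDiffOn_fderiv_apply hv _) φ hφc hy,
      integral_fderiv_slice_mul hv1 (∂_{b j} φ) (hcs _ hφc) hy, neg_neg]
  have hi1 (j : Fin n) : Integrable fun x => fderiv ℝ (fun p => fderiv ℝ v p (pt (b j) 0))
      (pt x y) (pt (b j) 0) * φ x := by
    have hc : ContinuousOn (fun p => fderiv ℝ (fun p => fderiv ℝ v p (pt (b j) 0)) p (pt (b j) 0))
        (upperHalfSpace n) :=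
      ((contDiffOn_fderiv_apply hv (pt (b j) 0)).continuousOn_fderiv_of_isOpen
        isOpen_upperHalfSpace le_rfl).clm_apply continuousOn_const
    exact ((continuous_slice hc hy).mul φ.continuous).integrable_of_hasCompactSupport hφc.mul_left
  have hi2 (j : Fin n) : Integrable fun x => v (pt x y) * (∂_{b j} (∂_{b j} φ)) x :=
    ((continuous_slice hv1.continuousOn hy).mul
      (∂_{b j} (∂_{b j} φ)).continuous).integrable_of_hasCompactSupport
      (hcs _ (hcs _ hφc)).mul_left
  have e1 : ∀ x, fderiv ℝ (fun p => fderiv ℝ v p (pt 0 1)) (pt x y) (pt 0 1) * φ x =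
      -∑ j, fderiv ℝ (fun p => fderiv ℝ v p (pt (b j) 0)) (pt x y) (pt (b j) 0) * φ x := by
    intro x
    rw [fderiv_fderiv_eq_neg_sum hv (pt_mem_upperHalfSpace.2 hy), neg_mul, Finset.sum_mul]
  have e2 : ∀ x, v (pt x y) * (-Δ φ) x = -∑ j, v (pt x y) * (∂_{b j} (∂_{b j} φ)) x := by
    intro x
    rw [SchwartzMap.laplacian_eq_sum b, _root_.neg_apply, _root_.sum_apply, mul_neg,
      Finset.mul_sum]
  simp_rw [e1, e2]
  rw [integral_neg, integral_neg, integral_finsetSum _ fun j _ => hi1 j,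
    integral_finsetSum _ fun j _ => hi2 j]
  simp_rw [hj]

end Slices

end HalfSpaceDirichlet

end

noncomputable section

namespace HalfSpaceDirichlet

open scoped SchwartzMap ContDiff FourierTransform LineDeriv Laplacian

section EvenTaylor

lemma hasDerivAt_pow_succ_div_factorial (k : ℕ) (t : ℝ) :
    HasDerivAt (fun t : ℝ => t ^ (k + 1) / ((k + 1).factorial : ℝ)) (t ^ k / (k.factorial : ℝ)) t := by
  refine ((hasDerivAt_pow (k + 1) t).div_const _).congr_deriv ?_
  rw [Nat.factorial_succ]
  push_cast
  have : (k.factorial : ℝ) ≠ 0 := by positivity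
  field_simp

/-- Taylor's formula for `g (y + h) + g (y - h)`, for a family of functions whose second
derivatives belong to the family. -/
lemma norm_even_taylor_le {X : Type*} (T : X → X) (g g' : X → ℝ → ℂ) (C : X → ℝ)
    (hC : ∀ x y, 0 < y → ‖g x y‖ ≤ C x)
    (h1 : ∀ x y, 0 < y → HasDerivAt (g x) (g' x y) y)
    (h2 : ∀ x y, 0 < y → HasDerivAt (g' x) (g (T x) y) y) (m : ℕ) (x : X) {y h : ℝ}
    (hh : 0 ≤ h) (hy : h < y) :
    ‖g x (y + h) + g x (y - h) -
      ∑ k ∈ Finset.range m, ((2 * (h ^ (2 * k) / ((2 * k).factorial : ℝ)) : ℝ) : ℂ) *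
        g (T^[k] x) y‖ ≤ 2 * C (T^[m] x) * (h ^ (2 * m) / ((2 * m).factorial : ℝ)) := by
  induction m generalizing x h with
  | zero =>
    simp only [Finset.range_zero, Finset.sum_empty, sub_zero, Function.iterate_zero, id_eq,
      mul_zero, pow_zero, Nat.factorial_zero, Nat.cast_one, div_one, mul_one]
    refine (norm_add_le _ _).trans ?_
    linarith [hC x (y + h) (by linarith), hC x (y - h) (by linarith)]
  | succ m ih =>
    set c : ℕ → ℂ := fun k => g (T^[k] (T x)) y with hc
    set D : ℝ := 2 * C (T^[m] (T x)) with hD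
    set A : ℝ → ℂ := fun t => g x (y + t) + g x (y - t) -
      (2 * g x y + ∑ k ∈ Finset.range m,
        ((2 * (t ^ (2 * k + 2) / ((2 * k + 2).factorial : ℝ)) : ℝ) : ℂ) * c k) with hA
    set A' : ℝ → ℂ := fun t => g' x (y + t) - g' x (y - t) -
      (∑ k ∈ Finset.range m,
        ((2 * (t ^ (2 * k + 1) / ((2 * k + 1).factorial : ℝ)) : ℝ) : ℂ) * c k) with hA'
    set A'' : ℝ → ℂ := fun t => g (T x) (y + t) + g (T x) (y - t) -
      (∑ k ∈ Finset.range m,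
        ((2 * (t ^ (2 * k) / ((2 * k).factorial : ℝ)) : ℝ) : ℂ) * c k) with hA''
    have hadd (f : ℝ → ℂ) (f' : ℂ) (t : ℝ) (hf : HasDerivAt f f' (y + t)) :
        HasDerivAt (fun t => f (y + t)) f' t := by
      simpa using hf.comp_const_add y t
    have hsub (f : ℝ → ℂ) (f' : ℂ) (t : ℝ) (hf : HasDerivAt f f' (y - t)) :
        HasDerivAt (fun t => f (y - t)) (-f') t := by
      simpa using hf.comp_const_sub y t
    have hpow (j : ℕ) (z : ℂ) (t : ℝ) : HasDerivAt
        (fun t : ℝ => ((2 * (t ^ (j + 1) / ((j + 1).factorial : ℝ)) : ℝ) : ℂ) * z)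
        (((2 * (t ^ j / (j.factorial : ℝ)) : ℝ) : ℂ) * z) t :=
      (((hasDerivAt_pow_succ_div_factorial j t).const_mul 2).ofReal_comp).mul_const z
    have dA (t : ℝ) (ht0 : 0 ≤ t) (ht : t ≤ h) : HasDerivAt A (A' t) t := by
      refine HasDerivAt.congr_deriv (((hadd _ _ t (h1 x _ (by linarith))).add
        (hsub _ _ t (h1 x _ (by linarith)))).sub
        ((HasDerivAt.fun_sum fun k _ => hpow (2 * k + 1) (c k) t).const_add (2 * g x y))) ?_
      simp only [hA']
      ring
    have dA' (t : ℝ) (ht0 : 0 ≤ t) (ht : t ≤ h) : HasDerivAt A' (A'' t) t := by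
      refine HasDerivAt.congr_deriv (((hadd _ _ t (h2 x _ (by linarith))).sub
        (hsub _ _ t (h2 x _ (by linarith)))).sub
        (HasDerivAt.fun_sum fun k _ => hpow (2 * k) (c k) t)) ?_
      simp only [hA'']
      ring
    have bA' : ∀ t ∈ Icc 0 h, ‖A' t‖ ≤ D * (t ^ (2 * m + 1) / ((2 * m + 1).factorial : ℝ)) := by
      refine image_norm_le_of_norm_deriv_right_le_deriv_boundary (f' := A'')
        (B' := fun t => D * (t ^ (2 * m) / ((2 * m).factorial : ℝ)))
        (fun t ht => (dA' t ht.1 ht.2).continuousAt.continuousWithinAt)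
        (fun t ht => (dA' t ht.1 ht.2.le).hasDerivWithinAt) ?_
        (fun t => (hasDerivAt_pow_succ_div_factorial (2 * m) t).const_mul D)
        (fun t ht => ih (T x) ht.1 (ht.2.trans hy))
      simp [hA']
    have bA : ∀ t ∈ Icc 0 h, ‖A t‖ ≤ D * (t ^ (2 * m + 2) / ((2 * m + 2).factorial : ℝ)) := by
      refine image_norm_le_of_norm_deriv_right_le_deriv_boundary (f' := A')
        (B' := fun t => D * (t ^ (2 * m + 1) / ((2 * m + 1).factorial : ℝ)))
        (fun t ht => (dA t ht.1 ht.2).continuousAt.continuousWithinAt)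
        (fun t ht => (dA t ht.1 ht.2.le).hasDerivWithinAt) ?_
        (fun t => (hasDerivAt_pow_succ_div_factorial (2 * m + 1) t).const_mul D)
        (fun t ht => bA' t (Ico_subset_Icc_self ht))
      simp [hA, two_mul]
    have := bA h ⟨hh, le_rfl⟩
    rw [Finset.sum_range_succ']
    simp only [hA, hc, hD] at this
    simp only [Function.iterate_succ, Function.comp_apply, mul_add, mul_one, Function.iterate_zero,
      id_eq, mul_zero, pow_zero, Nat.factorial_zero, Nat.cast_one, div_one, Complex.ofReal_ofNat]
    rw [add_comm (Finset.sum _ _)]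
    exact this

end EvenTaylor

section Pairing

variable {E : Type*} [NormedAddCommGroup E] [InnerProductSpace ℝ E] [FiniteDimensional ℝ E]
  [MeasurableSpace E] [BorelSpace E]

lemma norm_integral_mul_le (w : L2 E) (φ : 𝓢(E, ℂ)) :
    ‖∫ x, φ x * w x‖ ≤ ‖w‖ * ‖φ.toLp 2 volume‖ := by
  have h := L2.inner_def (𝕜 := ℂ) (star (φ.toLp 2 volume)) w
  have h2 : ∫ x, φ x * w x = inner ℂ (star (φ.toLp 2 volume)) w := by
    rw [h]
    refine integral_congr_ae ?_
    filter_upwards [φ.coeFn_toLp 2 volume, Lp.coeFn_star (φ.toLp 2 volume)] with x h1 h2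
    rw [h2]
    simp [h1, mul_comm]
  rw [h2, mul_comm]
  refine (norm_inner_le_norm _ _).trans (le_of_eq ?_)
  congr 1
  rw [Lp.norm_def, Lp.norm_def]
  refine congrArg ENNReal.toReal (eLpNorm_congr_norm_ae ?_)
  filter_upwards [Lp.coeFn_star (φ.toLp 2 volume)] with x h2
  rw [h2]
  simp

lemma continuous_integral_mul (w : L2 E) : Continuous fun φ : 𝓢(E, ℂ) => ∫ x, φ x * w x := by
  have h : (fun φ : 𝓢(E, ℂ) => ∫ x, φ x * w x) = fun φ => Lp.toTemperedDistribution w φ := by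
    ext φ
    rw [Lp.toTemperedDistribution_apply]
    rfl
  rw [h]
  exact (Lp.toTemperedDistribution w).continuous

/-- A bounded family `U : (0, ∞) → L²` with `U'' = -Δ U` in the sense of distributions in `x`. -/
structure IsHarmonicFamily (U : ℝ → L2 E) (M : ℝ) : Prop where
  norm_le : ∀ y, 0 < y → ‖U y‖ ≤ M
  hasDerivAt : ∀ φ : 𝓢(E, ℂ), HasCompactSupport φ → ∃ g' : ℝ → ℂ, ∀ y, 0 < y →
    HasDerivAt (fun y => ∫ x, φ x * U y x) (g' y) y ∧
    HasDerivAt g' (∫ x, (-Δ φ) x * U y x) y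

/-- The even Taylor estimate for the pairings with arbitrary Schwartz functions. -/
lemma norm_even_taylor_pairing_le {U : ℝ → L2 E} {M : ℝ} (hU : IsHarmonicFamily U M)
    (m : ℕ) (φ : 𝓢(E, ℂ)) {y h : ℝ} (hh : 0 ≤ h) (hy : h < y) :
    ‖(∫ x, φ x * U (y + h) x) + (∫ x, φ x * U (y - h) x) -
      ∑ k ∈ Finset.range m, ((2 * (h ^ (2 * k) / ((2 * k).factorial : ℝ)) : ℝ) : ℂ) *
        ∫ x, ((fun φ : 𝓢(E, ℂ) => -Δ φ)^[k] φ) x * U y x‖ ≤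
      2 * (M * ‖((fun φ : 𝓢(E, ℂ) => -Δ φ)^[m] φ).toLp 2 volume‖) *
        (h ^ (2 * m) / ((2 * m).factorial : ℝ)) := by
  set T : 𝓢(E, ℂ) → 𝓢(E, ℂ) := fun φ => -Δ φ with hT
  have hTc : Continuous T := (LineDeriv.laplacianCLM ℝ E 𝓢(E, ℂ)).continuous.neg
  have hTk (k : ℕ) : Continuous (T^[k]) := hTc.iterate k
  have hcs (φ : 𝓢(E, ℂ)) (hφ : HasCompactSupport φ) : HasCompactSupport (T φ) := by
    have : ((T φ : 𝓢(E, ℂ)) : E → ℂ) = -((Δ φ : 𝓢(E, ℂ)) : E → ℂ) := by ext x; simp [hT]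
    rw [this]
    exact (hasCompactSupport_laplacian hφ).comp_left (g := fun z : ℂ => -z) neg_zero
  have key : ∀ φ : 𝓢(E, ℂ), HasCompactSupport φ →
      ‖(∫ x, φ x * U (y + h) x) + (∫ x, φ x * U (y - h) x) -
      ∑ k ∈ Finset.range m, ((2 * (h ^ (2 * k) / ((2 * k).factorial : ℝ)) : ℝ) : ℂ) *
        ∫ x, (T^[k] φ) x * U y x‖ ≤ 2 * (M * ‖(T^[m] φ).toLp 2 volume‖) *
        (h ^ (2 * m) / ((2 * m).factorial : ℝ)) := by
    intro φ hφ
    choose g' hg' using fun z : {φ : 𝓢(E, ℂ) // HasCompactSupport φ} => hU.hasDerivAt z.1 z.2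
    have := norm_even_taylor_le (X := {φ : 𝓢(E, ℂ) // HasCompactSupport φ})
      (fun z => ⟨T z.1, hcs z.1 z.2⟩) (fun z y => ∫ x, z.1 x * U y x) g'
      (fun z => M * ‖z.1.toLp 2 volume‖)
      (fun z y hy => (norm_integral_mul_le _ _).trans
        (mul_le_mul_of_nonneg_right (hU.norm_le y hy) (norm_nonneg _)))
      (fun z y hy => (hg' z y hy).1) (fun z y hy => (hg' z y hy).2) m ⟨φ, hφ⟩ hh hy
    have hit (k : ℕ) : (((fun z : {φ : 𝓢(E, ℂ) // HasCompactSupport φ} =>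
        (⟨T z.1, hcs z.1 z.2⟩ : {φ : 𝓢(E, ℂ) // HasCompactSupport φ}))^[k] ⟨φ, hφ⟩).1) =
        T^[k] φ := by
      induction k with
      | zero => rfl
      | succ k ih => rw [Function.iterate_succ_apply', Function.iterate_succ_apply', ← ih]
    simp only [hit] at this
    exact this
  obtain ⟨φs, hφs, hlim⟩ := exists_seq_hasCompactSupport_tendsto φ
  have hL : Continuous fun φ : 𝓢(E, ℂ) => ‖(∫ x, φ x * U (y + h) x) + (∫ x, φ x * U (y - h) x) -
      ∑ k ∈ Finset.range m, ((2 * (h ^ (2 * k) / ((2 * k).factorial : ℝ)) : ℝ) : ℂ) *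
        ∫ x, (T^[k] φ) x * U y x‖ :=
    (((continuous_integral_mul _).add (continuous_integral_mul _)).sub
      (continuous_finsetSum _ fun k _ => continuous_const.mul
        ((continuous_integral_mul (U y)).comp (hTk k)))).norm
  have hR : Continuous fun φ : 𝓢(E, ℂ) => 2 * (M * ‖(T^[m] φ).toLp 2 volume‖) *
        (h ^ (2 * m) / ((2 * m).factorial : ℝ)) :=
    (continuous_const.mul (continuous_const.mul
      ((SchwartzMap.continuous_toLp (p := 2) (μ := volume)).comp (hTk m)).norm)).mul
      continuous_const
  exact le_of_tendsto_of_tendsto' ((hL.tendsto φ).comp hlim) ((hR.tendsto φ).comp hlim)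
    fun k => key (φs k) (hφs k)

end Pairing

end HalfSpaceDirichlet

end

noncomputable section

namespace HalfSpaceDirichlet

open scoped SchwartzMap ContDiff FourierTransform LineDeriv Laplacian

section Semigroup

variable {E : Type*} [NormedAddCommGroup E]

/-- The symbol of `-Δ`. -/
def negLaplacianSymbol (ξ : E) : ℝ := (2 * Real.pi) ^ 2 * ‖ξ‖ ^ 2

lemma negLaplacianSymbol_pow (ξ : E) (k : ℕ) :
    negLaplacianSymbol ξ ^ k = (2 * Real.pi * ‖ξ‖) ^ (2 * k) := by
  rw [negLaplacianSymbol, ← mul_pow, pow_mul]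

variable [InnerProductSpace ℝ E]

lemma hasTemperateGrowth_negLaplacianSymbol :
    (negLaplacianSymbol : E → ℝ).HasTemperateGrowth := by
  unfold negLaplacianSymbol
  fun_prop

variable [FiniteDimensional ℝ E] [MeasurableSpace E] [BorelSpace E]

lemma neg_laplacian_fourier (ψ : 𝓢(E, ℂ)) :
    -Δ (𝓕 ψ : 𝓢(E, ℂ)) = 𝓕 (SchwartzMap.smulLeftCLM ℂ (negLaplacianSymbol : E → ℝ) ψ) := by
  set b := stdOrthonormalBasis ℝ E
  have hin (m : E) : (fun ξ : E => inner ℝ ξ m).HasTemperateGrowth := by fun_prop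
  have h1 : SchwartzMap.smulLeftCLM ℂ (negLaplacianSymbol : E → ℝ) ψ =
      -∑ i, (-(2 * Real.pi * Complex.I) • SchwartzMap.smulLeftCLM ℂ (inner ℝ · (b i))
        (-(2 * Real.pi * Complex.I) • SchwartzMap.smulLeftCLM ℂ (inner ℝ · (b i)) ψ)) := by
    ext ξ
    rw [SchwartzMap.smulLeftCLM_apply_apply hasTemperateGrowth_negLaplacianSymbol,
      _root_.neg_apply, _root_.sum_apply]
    simp only [_root_.smul_apply, SchwartzMap.smulLeftCLM_apply_apply (hin _), negLaplacianSymbol,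
      ← b.sum_sq_inner_left]
    simp only [Complex.real_smul, smul_eq_mul, Finset.mul_sum, Complex.ofReal_sum, Finset.sum_mul,
      ← Finset.sum_neg_distrib]
    refine Finset.sum_congr rfl fun i _ => ?_
    push_cast
    linear_combination (4 * (Real.pi : ℂ) ^ 2 * (inner ℝ ξ (b i) : ℝ) ^ 2 * ψ ξ) * Complex.I_sq
  rw [SchwartzMap.laplacian_eq_sum b, h1]
  simp_rw [SchwartzMap.lineDerivOp_fourier_eq]
  have hneg (f : 𝓢(E, ℂ)) : 𝓕 (-f) = -𝓕 f := map_neg (FourierTransform.fourierCLM ℂ 𝓢(E, ℂ)) f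
  have hsum (f : Fin (Module.finrank ℝ E) → 𝓢(E, ℂ)) : 𝓕 (∑ i, f i) = ∑ i, 𝓕 (f i) :=
    map_sum (FourierTransform.fourierCLM ℂ 𝓢(E, ℂ)) f _
  rw [hneg, hsum]

lemma iterate_neg_laplacian_fourier (ψ : 𝓢(E, ℂ)) (k : ℕ) :
    ∃ ψk : 𝓢(E, ℂ), (fun φ : 𝓢(E, ℂ) => -Δ φ)^[k] (𝓕 ψ) = 𝓕 ψk ∧
      ∀ ξ, ψk ξ = ((negLaplacianSymbol ξ ^ k : ℝ) : ℂ) * ψ ξ := by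
  induction k with
  | zero => exact ⟨ψ, rfl, fun ξ => by simp⟩
  | succ k ih =>
    obtain ⟨ψk, h1, h2⟩ := ih
    refine ⟨SchwartzMap.smulLeftCLM ℂ (negLaplacianSymbol : E → ℝ) ψk, ?_, fun ξ => ?_⟩
    · rw [Function.iterate_succ_apply', h1, neg_laplacian_fourier]
    · rw [SchwartzMap.smulLeftCLM_apply_apply hasTemperateGrowth_negLaplacianSymbol, h2,
        Complex.real_smul]
      push_cast
      ring

lemma integral_mul_cosh {U : ℝ → L2 E} {M : ℝ} (hU : IsHarmonicFamily U M) {y h : ℝ}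
    (hh : 0 ≤ h) (hy : h < y) (ψ : 𝓢(E, ℂ)) (hψ : HasCompactSupport ψ) :
    (∫ ξ, ψ ξ * (𝓕 (U (y + h)) : L2 E) ξ) + (∫ ξ, ψ ξ * (𝓕 (U (y - h)) : L2 E) ξ) =
      ∫ ξ, ((2 * Real.cosh (2 * Real.pi * ‖ξ‖ * h) : ℝ) : ℂ) * (ψ ξ * (𝓕 (U y) : L2 E) ξ) := by
  obtain ⟨R, hR⟩ := hψ.isCompact.isBounded.exists_norm_le
  have hRψ (ξ : E) (hξ : ψ ξ ≠ 0) : ‖ξ‖ ≤ max R 0 :=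
    (hR ξ (subset_tsupport _ hξ)).trans (le_max_left _ _)
  set r : ℝ := 2 * Real.pi * max R 0 with hr
  have hr0 : 0 ≤ r := by positivity
  have hqr (k : ℕ) (ξ : E) (hξ : ψ ξ ≠ 0) : (2 * Real.pi * ‖ξ‖) ^ (2 * k) ≤ r ^ (2 * k) := by
    have := hRψ ξ hξ
    exact pow_le_pow_left₀ (by positivity) (by rw [hr]; gcongr) _
  set a : ℕ → ℝ := fun k => 2 * (h ^ (2 * k) / ((2 * k).factorial : ℝ)) with ha
  have ha0 (k : ℕ) : 0 ≤ a k := by positivity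
  choose ψk hψk hψk' using iterate_neg_laplacian_fourier ψ
  have hψV : Integrable fun ξ => ψ ξ * (𝓕 (U y) : L2 E) ξ := by
    have h1 : MemLp (fun ξ => (𝓕 (U y) : L2 E) ξ) 2 volume := Lp.memLp _
    exact (ψ.memLp 2 volume).integrable_mul h1
  have hfac (k : ℕ) (ξ : E) : a k * (2 * Real.pi * ‖ξ‖) ^ (2 * k) =
      2 * ((2 * Real.pi * ‖ξ‖ * h) ^ (2 * k) / ((2 * k).factorial : ℝ)) := by
    simp only [ha]; rw [mul_pow _ h]; ring
  have hsum : HasSum (fun k => (a k : ℂ) * ∫ ξ, ψk k ξ * (𝓕 (U y) : L2 E) ξ)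
      (∫ ξ, ((2 * Real.cosh (2 * Real.pi * ‖ξ‖ * h) : ℝ) : ℂ) *
        (ψ ξ * (𝓕 (U y) : L2 E) ξ)) := by
    simp_rw [← integral_const_mul]
    have hs : HasSum (fun k => 2 * ((r * h) ^ (2 * k) / ((2 * k).factorial : ℝ)))
      (2 * Real.cosh (r * h)) := (Real.hasSum_cosh _).mul_left 2
    refine hasSum_integral_of_dominated_convergence
      (fun k ξ => 2 * ((r * h) ^ (2 * k) / ((2 * k).factorial : ℝ)) *
        ‖ψ ξ * (𝓕 (U y) : L2 E) ξ‖)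
      (fun k => ((((ψk k).continuous.aestronglyMeasurable.mul
        (Lp.aestronglyMeasurable _))).const_mul _))
      (fun k => ae_of_all _ fun ξ => ?_) (ae_of_all _ fun ξ => (hs.summable.mul_right _))
      ?_ (ae_of_all _ fun ξ => ?_)
    · rw [hψk', negLaplacianSymbol_pow, mul_assoc, norm_mul, norm_mul, Complex.norm_real,
        Complex.norm_real, Real.norm_of_nonneg (ha0 k), Real.norm_of_nonneg (by positivity),
        ← mul_assoc]
      by_cases hξ : ψ ξ = 0
      · simp [hξ]
      · refine mul_le_mul_of_nonneg_right ?_ (norm_nonneg _)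
        calc a k * (2 * Real.pi * ‖ξ‖) ^ (2 * k) ≤ a k * r ^ (2 * k) :=
              mul_le_mul_of_nonneg_left (hqr k ξ hξ) (ha0 k)
          _ = _ := by simp only [ha]; rw [mul_pow]; ring
    · simp_rw [(hs.mul_right _).tsum_eq]
      exact hψV.norm.const_mul _
    · have h1 := ((Real.hasSum_cosh (2 * Real.pi * ‖ξ‖ * h)).mul_left 2)
      have h2 := (Complex.hasSum_ofReal.2 h1).mul_right (ψ ξ * (𝓕 (U y) : L2 E) ξ)
      refine h2.congr_fun fun k => ?_
      rw [hψk', negLaplacianSymbol_pow, ← hfac]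
      push_cast
      ring
  have hbound (m : ℕ) : ‖(∫ ξ, ψ ξ * (𝓕 (U (y + h)) : L2 E) ξ) +
      (∫ ξ, ψ ξ * (𝓕 (U (y - h)) : L2 E) ξ) -
      ∑ k ∈ Finset.range m, (a k : ℂ) * ∫ ξ, ψk k ξ * (𝓕 (U y) : L2 E) ξ‖ ≤
      2 * (M * ‖ψ.toLp 2 volume‖) * ((r * h) ^ (2 * m) / ((2 * m).factorial : ℝ)) := by
    have h1 := norm_even_taylor_pairing_le hU m (𝓕 ψ) hh hy
    simp only [hψk, ← integral_mul_fourier] at h1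
    refine h1.trans ?_
    have h2 : ‖(𝓕 (ψk m) : 𝓢(E, ℂ)).toLp 2 volume‖ ≤ r ^ (2 * m) * ‖ψ.toLp 2 volume‖ := by
      rw [SchwartzMap.norm_fourier_toL2_eq]
      refine Lp.norm_le_mul_norm_of_ae_le_mul ?_
      filter_upwards [(ψk m).coeFn_toLp 2 volume, ψ.coeFn_toLp 2 volume] with ξ e1 e2
      rw [e1, e2, hψk', negLaplacianSymbol_pow, norm_mul, Complex.norm_real,
        Real.norm_of_nonneg (by positivity)]
      by_cases hξ : ψ ξ = 0
      · simp [hξ]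
      · exact mul_le_mul_of_nonneg_right (hqr m ξ hξ) (norm_nonneg _)
    have hM0 : 0 ≤ M := (norm_nonneg _).trans (hU.norm_le 1 one_pos)
    calc _ ≤ 2 * (M * (r ^ (2 * m) * ‖ψ.toLp 2 volume‖)) *
          (h ^ (2 * m) / ((2 * m).factorial : ℝ)) := by gcongr
      _ = _ := by rw [mul_pow]; ring
  have hz : Tendsto (fun m : ℕ => 2 * (M * ‖ψ.toLp 2 volume‖) *
      ((r * h) ^ (2 * m) / ((2 * m).factorial : ℝ))) atTop (𝓝 0) := by
    have := ((FloorSemiring.tendsto_pow_div_factorial_atTop (r * h)).comp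
      (tendsto_id.const_mul_atTop' (two_pos : (0 : ℕ) < 2))).const_mul
      (2 * (M * ‖ψ.toLp 2 volume‖))
    simpa [Function.comp_def] using this
  have h3 := squeeze_zero_norm hbound hz
  have h4 := hsum.tendsto_sum_nat
  have h5 := h3.add h4
  simp only [sub_add_cancel, zero_add] at h5
  exact tendsto_nhds_unique tendsto_const_nhds h5

/-- `Û(y + h) + Û(y - h) = 2 cosh(2π|ξ|h) Û(y)`. -/
lemma fourier_add_fourier_ae_eq {U : ℝ → L2 E} {M : ℝ} (hU : IsHarmonicFamily U M) {y h : ℝ}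
    (hh : 0 ≤ h) (hy : h < y) :
    ∀ᵐ ξ : E, (𝓕 (U (y + h)) : L2 E) ξ + (𝓕 (U (y - h)) : L2 E) ξ =
      ((2 * Real.cosh (2 * Real.pi * ‖ξ‖ * h) : ℝ) : ℂ) * (𝓕 (U y) : L2 E) ξ := by
  have hm (y : ℝ) : MemLp (fun ξ => (𝓕 (U y) : L2 E) ξ) 2 volume := Lp.memLp _
  have hcont : Continuous fun ξ : E => ((2 * Real.cosh (2 * Real.pi * ‖ξ‖ * h) : ℝ) : ℂ) := by
    have := Real.continuous_cosh
    fun_prop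
  have hl (y : ℝ) : LocallyIntegrable (fun ξ => (𝓕 (U y) : L2 E) ξ) volume :=
    (hm y).locallyIntegrable one_le_two
  refine ae_eq_of_integral_contDiff_smul_eq ((hl _).add (hl _)) ((hl y).continuous_smul hcont)
    fun ψ hψ hψc => ?_
  have hs1 : HasCompactSupport (fun ξ => (ψ ξ : ℂ)) :=
    hψc.comp_left (g := fun r : ℝ => (r : ℂ)) Complex.ofReal_zero
  have hc1 : ContDiff ℝ ∞ (fun ξ => (ψ ξ : ℂ)) := Complex.ofRealCLM.contDiff.comp hψ
  set Ψ : 𝓢(E, ℂ) := hs1.toSchwartzMap hc1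
  have hi (y : ℝ) : Integrable fun ξ => Ψ ξ * (𝓕 (U y) : L2 E) ξ :=
    (Ψ.memLp 2 volume).integrable_mul (hm y)
  have key := integral_mul_cosh hU hh hy Ψ hs1
  rw [← integral_add (hi _) (hi _)] at key
  refine Eq.trans (integral_congr_ae (ae_of_all _ fun ξ => ?_))
    (key.trans (integral_congr_ae (ae_of_all _ fun ξ => ?_)))
  · change ψ ξ • (_ + _) = (ψ ξ : ℂ) * _ + (ψ ξ : ℂ) * _
    rw [Complex.real_smul, mul_add]
  · change _ * ((ψ ξ : ℂ) * _) = ψ ξ • ((_ : ℂ) • (_ : ℂ))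
    rw [Complex.real_smul, smul_eq_mul]
    ring

end Semigroup

end HalfSpaceDirichlet

end

noncomputable section

namespace HalfSpaceDirichlet

open scoped SchwartzMap ContDiff FourierTransform LineDeriv Laplacian

section BoundarySpectrum

variable {E : Type*} [NormedAddCommGroup E]

/-- The symbol `e^{-2π|ξ|y}` of the Poisson kernel. -/
def poissonSymbol (y : ℝ) (ξ : E) : ℝ := Real.exp (-(2 * Real.pi * ‖ξ‖ * y))

lemma poissonSymbol_pos (y : ℝ) (ξ : E) : 0 < poissonSymbol y ξ := Real.exp_pos _

variable [InnerProductSpace ℝ E] [FiniteDimensional ℝ E] [MeasurableSpace E] [BorelSpace E]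

lemma fourier_add_ae_eq [Nontrivial E] {U : ℝ → L2 E} {M : ℝ} (hU : IsHarmonicFamily U M)
    {y h : ℝ} (hy : 0 < y) (hh : 0 < h) :
    (𝓕 (U (y + h)) : L2 E) =ᵐ[volume] fun ξ =>
      (poissonSymbol h ξ : ℂ) * (𝓕 (U y) : L2 E) ξ := by
  set v : ℕ → E → ℂ := fun k => (𝓕 (U (y + k * h)) : L2 E) with hv
  set c : E → ℝ := fun ξ => 2 * Real.pi * ‖ξ‖ * h with hc
  have hc0 (ξ : E) : 0 ≤ c ξ := by positivity
  set w : ℕ → E → ℂ := fun k ξ => v (k + 1) ξ - (poissonSymbol h ξ : ℂ) * v k ξ with hw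
  have hvm (k : ℕ) : MemLp (v k) 2 volume := Lp.memLp _
  have hPc : Continuous fun ξ : E => (poissonSymbol h ξ : ℂ) := by
    unfold poissonSymbol; fun_prop
  have hP1 (ξ : E) : ‖(poissonSymbol h ξ : ℂ)‖ ≤ 1 := by
    rw [Complex.norm_real, Real.norm_of_nonneg (poissonSymbol_pos h ξ).le]
    exact Real.exp_le_one_iff.2 (neg_nonpos.2 (hc0 ξ))
  have hvn (k : ℕ) : eLpNorm (v k) 2 volume ≤ ENNReal.ofReal M := by
    have h1 : ‖(𝓕 (U (y + k * h)) : L2 E)‖ ≤ M := by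
      rw [Lp.norm_fourier_eq]
      exact hU.norm_le _ (by positivity)
    have h2 : eLpNorm (v k) 2 volume = ENNReal.ofReal ‖(𝓕 (U (y + k * h)) : L2 E)‖ := by
      rw [ofReal_norm, Lp.enorm_def]
    rw [h2]
    exact ENNReal.ofReal_le_ofReal h1
  have hwn (k : ℕ) : ∫⁻ ξ, ‖w k ξ‖ₑ ^ 2 ≤ (ENNReal.ofReal M + ENNReal.ofReal M) ^ 2 := by
    rw [← eLpNorm_two_sq]
    gcongr
    refine (eLpNorm_sub_le (hvm _).1 (hPc.aestronglyMeasurable.mul (hvm k).1) one_le_two).trans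
      (add_le_add (hvn _) (le_trans (eLpNorm_mono fun ξ => ?_) (hvn k)))
    rw [Pi.mul_apply, norm_mul]
    exact mul_le_of_le_one_left (norm_nonneg _) (hP1 ξ)
  have hrec : ∀ᵐ ξ : E, ∀ k : ℕ, w (k + 1) ξ = (Real.exp (c ξ) : ℂ) * w k ξ := by
    rw [ae_all_iff]
    intro k
    have h1 := fourier_add_fourier_ae_eq hU (y := y + ((k + 1 : ℕ) : ℝ) * h) hh.le
      (by have : 0 ≤ (k : ℝ) * h := by positivity
          push_cast; linarith)
    have e1 : y + ((k + 1 : ℕ) : ℝ) * h + h = y + ((k + 1 + 1 : ℕ) : ℝ) * h := by push_cast; ring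
    have e2 : y + ((k + 1 : ℕ) : ℝ) * h - h = y + ((k : ℕ) : ℝ) * h := by push_cast; ring
    rw [e1, e2] at h1
    filter_upwards [h1] with ξ hξ
    have h2 : v (k + 1 + 1) ξ = ((2 * Real.cosh (c ξ) : ℝ) : ℂ) * v (k + 1) ξ - v k ξ :=
      eq_sub_of_add_eq hξ
    have h3 : (Real.exp (c ξ) : ℂ) * (poissonSymbol h ξ : ℂ) = 1 := by
      rw [← Complex.ofReal_mul, poissonSymbol, ← Real.exp_add]
      simp [hc]
    have h4 : ((2 * Real.cosh (c ξ) : ℝ) : ℂ) = Real.exp (c ξ) + poissonSymbol h ξ := by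
      rw [Real.cosh_eq, show poissonSymbol h ξ = Real.exp (-c ξ) from rfl]
      push_cast
      ring
    simp only [hw]
    rw [h2, h4]
    linear_combination v k ξ * h3
  have hpow : ∀ᵐ ξ : E, ∀ k : ℕ, w k ξ = (Real.exp (k * c ξ) : ℂ) * w 0 ξ := by
    filter_upwards [hrec] with ξ hξ k
    induction k with
    | zero => simp
    | succ k ih =>
      rw [hξ, ih, ← mul_assoc, ← Complex.ofReal_mul, ← Real.exp_add]
      congr 4
      push_cast; ring
  have hlow (k : ℕ) : (k : ℝ≥0∞) * ∫⁻ ξ, ENNReal.ofReal (c ξ) * ‖w 0 ξ‖ₑ ^ 2 ≤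
      (ENNReal.ofReal M + ENNReal.ofReal M) ^ 2 := by
    refine le_trans ?_ (hwn k)
    rw [← lintegral_const_mul' _ _ (ENNReal.natCast_ne_top k)]
    refine lintegral_mono_ae ?_
    filter_upwards [hpow] with ξ hξ
    rw [hξ k, enorm_mul, mul_pow, ← mul_assoc]
    gcongr
    rw [← ofReal_norm, Complex.norm_real, Real.norm_of_nonneg (Real.exp_nonneg _),
      ← ENNReal.ofReal_pow (Real.exp_nonneg _), ← ENNReal.ofReal_natCast,
      ← ENNReal.ofReal_mul (Nat.cast_nonneg k)]
    refine ENNReal.ofReal_le_ofReal ?_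
    have h0 : 0 ≤ (k : ℝ) * c ξ := mul_nonneg (Nat.cast_nonneg k) (hc0 ξ)
    have h1 := Real.add_one_le_exp ((k : ℝ) * c ξ)
    have h2 := Real.one_le_exp h0
    nlinarith
  have hzero : ∫⁻ ξ, ENNReal.ofReal (c ξ) * ‖w 0 ξ‖ₑ ^ 2 = 0 := by
    by_contra hne
    obtain ⟨k, hk⟩ := ENNReal.exists_nat_mul_gt hne
      (b := (ENNReal.ofReal M + ENNReal.ofReal M) ^ 2) (by finiteness)
    exact (hk.trans_le (hlow k)).false
  have hw0 : AEStronglyMeasurable (w 0) volume :=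
    (hvm 1).1.sub (hPc.aestronglyMeasurable.mul (hvm 0).1)
  have hcm : Measurable c := by simp only [hc]; fun_prop
  rw [lintegral_eq_zero_iff' (by fun_prop)] at hzero
  filter_upwards [hzero, Measure.ae_ne volume (0 : E)] with ξ hξ hne
  have h1 : 0 < c ξ := by have := norm_pos_iff.2 hne; positivity
  simp only [Pi.zero_apply, mul_eq_zero, ENNReal.ofReal_eq_zero, not_le.2 h1, false_or,
    ne_eq, OfNat.ofNat_ne_zero, not_false_eq_true, pow_eq_zero_iff, enorm_eq_zero] at hξ
  simpa [hw, hv, sub_eq_zero] using hξ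

/-- The Fourier transforms of a bounded harmonic family are `e^{-2π|ξ|y} F(ξ)` with `F ∈ L²`. -/
lemma exists_boundary_spectrum [Nontrivial E] {U : ℝ → L2 E} {M : ℝ}
    (hU : IsHarmonicFamily U M) :
    ∃ F : E → ℂ, MemLp F 2 volume ∧ ∀ y, 0 < y →
      (𝓕 (U y) : L2 E) =ᵐ[volume] fun ξ => (poissonSymbol y ξ : ℂ) * F ξ := by
  set F : E → ℂ := fun ξ => (poissonSymbol (-1) ξ : ℂ) * (𝓕 (U 1) : L2 E) ξ with hF
  have hmul (a b : ℝ) (ξ : E) : (poissonSymbol a ξ : ℂ) * (poissonSymbol b ξ : ℂ) =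
      (poissonSymbol (a + b) ξ : ℂ) := by
    rw [← Complex.ofReal_mul, poissonSymbol, poissonSymbol, ← Real.exp_add, poissonSymbol]
    congr 2; ring
  have h0 (ξ : E) : (poissonSymbol 0 ξ : ℂ) = 1 := by simp [poissonSymbol]
  have hy (y : ℝ) (hy : 0 < y) :
      (𝓕 (U y) : L2 E) =ᵐ[volume] fun ξ => (poissonSymbol y ξ : ℂ) * F ξ := by
    rcases lt_trichotomy y 1 with h | h | h
    · have h1 := fourier_add_ae_eq hU hy (h := 1 - y) (by linarith)
      rw [add_sub_cancel] at h1
      filter_upwards [h1] with ξ hξ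
      simp only [hF]
      rw [hξ, ← mul_assoc, ← mul_assoc, hmul, hmul]
      ring_nf
      rw [h0, one_mul]
    · subst h
      refine Eventually.of_forall fun ξ => ?_
      simp only [hF]
      rw [← mul_assoc, hmul, add_neg_cancel, h0, one_mul]
    · have h1 := fourier_add_ae_eq hU one_pos (h := y - 1) (by linarith)
      rw [add_sub_cancel] at h1
      filter_upwards [h1] with ξ hξ
      simp only [hF]
      rw [hξ, ← mul_assoc, hmul]
      ring_nf
  have hPc (y : ℝ) : Continuous fun ξ : E => (poissonSymbol y ξ : ℂ) := by
    unfold poissonSymbol; fun_prop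
  have hFm : AEStronglyMeasurable F volume :=
    (hPc (-1)).aestronglyMeasurable.mul (Lp.aestronglyMeasurable _)
  refine ⟨F, memLp_two_of_lintegral_lt_top hFm ?_, hy⟩
  have hlim (ξ : E) : Tendsto (fun k : ℕ => ‖(poissonSymbol (1 / ((k : ℝ) + 1)) ξ : ℂ) * F ξ‖ₑ ^ 2)
      atTop (𝓝 (‖F ξ‖ₑ ^ 2)) := by
    have h1 : Continuous fun y : ℝ => ‖(poissonSymbol y ξ : ℂ) * F ξ‖ₑ ^ 2 := by
      unfold poissonSymbol; fun_prop
    have h2 := (h1.tendsto 0).comp (tendsto_one_div_add_atTop_nhds_zero_nat (𝕜 := ℝ))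
    rw [h0, one_mul] at h2
    exact h2
  have hle : ∫⁻ ξ, ‖F ξ‖ₑ ^ 2 ≤ ENNReal.ofReal M ^ 2 := by
    calc ∫⁻ ξ, ‖F ξ‖ₑ ^ 2
        = ∫⁻ ξ, liminf (fun k : ℕ => ‖(poissonSymbol (1 / ((k : ℝ) + 1)) ξ : ℂ) * F ξ‖ₑ ^ 2)
            atTop := lintegral_congr fun ξ => (hlim ξ).liminf_eq.symm
      _ ≤ liminf (fun k : ℕ => ∫⁻ ξ, ‖(poissonSymbol (1 / ((k : ℝ) + 1)) ξ : ℂ) * F ξ‖ₑ ^ 2)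
            atTop := lintegral_liminf_le' fun k =>
              (((hPc _).aestronglyMeasurable.mul hFm).enorm.pow_const 2)
      _ ≤ ENNReal.ofReal M ^ 2 := by
          refine liminf_le_of_le (by isBoundedDefault) fun b hb => ?_
          obtain ⟨k, hk⟩ := hb.exists
          refine hk.trans ?_
          have hpos : (0 : ℝ) < 1 / ((k : ℝ) + 1) := by positivity
          have h1 : ∫⁻ ξ, ‖(poissonSymbol (1 / ((k : ℝ) + 1)) ξ : ℂ) * F ξ‖ₑ ^ 2 =
              ∫⁻ ξ, ‖(𝓕 (U (1 / ((k : ℝ) + 1))) : L2 E) ξ‖ₑ ^ 2 := by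
            refine lintegral_congr_ae ?_
            filter_upwards [hy _ hpos] with ξ hξ
            rw [hξ]
          rw [h1, ← eLpNorm_two_sq, ← Lp.enorm_def, ← ofReal_norm, Lp.norm_fourier_eq]
          gcongr
          exact hU.norm_le _ hpos
  exact hle.trans_lt (by finiteness)

/-- `F` is the Fourier transform of the boundary function. -/
lemma exists_fourier_boundary {U : ℝ → L2 E} {F f : E → ℂ} (hF : MemLp F 2 volume)
    (hUF : ∀ y, 0 < y → (𝓕 (U y) : L2 E) =ᵐ[volume] fun ξ => (poissonSymbol y ξ : ℂ) * F ξ)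
    (hf : ∀ᵐ x : E, Tendsto (fun k : ℕ => U (1 / ((k : ℝ) + 1)) x) atTop (𝓝 (f x))) :
    ∃ w : L2 E, w =ᵐ[volume] f ∧ (𝓕 w : L2 E) =ᵐ[volume] F := by
  have hpos (k : ℕ) : (0 : ℝ) < 1 / ((k : ℝ) + 1) := by positivity
  refine exists_fourier_eq_of_tendsto (g := fun k : ℕ => U (1 / ((k : ℝ) + 1))) hF.norm
    (fun k => ?_) ?_ hf
  · filter_upwards [hUF _ (hpos k)] with ξ hξ
    rw [hξ, norm_mul, Complex.norm_real, Real.norm_of_nonneg (poissonSymbol_pos _ ξ).le]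
    refine mul_le_of_le_one_left (norm_nonneg _) (Real.exp_le_one_iff.2 (neg_nonpos.2 ?_))
    have := hpos k
    have := Real.pi_pos
    positivity
  · filter_upwards [ae_all_iff.2 fun k : ℕ => hUF _ (hpos k)] with ξ hξ
    simp_rw [hξ]
    have h1 : Continuous fun y : ℝ => (poissonSymbol y ξ : ℂ) * F ξ := by
      unfold poissonSymbol; fun_prop
    have h2 := (h1.tendsto 0).comp (tendsto_one_div_add_atTop_nhds_zero_nat (𝕜 := ℝ))
    have h0 : (poissonSymbol 0 ξ : ℂ) = 1 := by simp [poissonSymbol]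
    rw [h0, one_mul] at h2
    exact h2

/-- Plancherel's identity for the limit of difference quotients. -/
lemma lintegral_sq_of_tendsto_multiplier {g : ℕ → L2 E} {d F m : E → ℂ} {μ : ℕ → E → ℂ} {C y : ℝ}
    (hF : MemLp F 2 volume) (hy : 0 < y) (hC : 0 ≤ C)
    (hμ : ∀ k ξ, ‖μ k ξ‖ ≤ C * (2 * Real.pi * ‖ξ‖))
    (hm : ∀ ξ, Tendsto (fun k => μ k ξ) atTop (𝓝 (m ξ)))
    (hg : ∀ k, (𝓕 (g k) : L2 E) =ᵐ[volume] fun ξ => μ k ξ * ((poissonSymbol y ξ : ℂ) * F ξ))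
    (hd : ∀ᵐ x : E, Tendsto (fun k => g k x) atTop (𝓝 (d x))) :
    ∫⁻ x, ‖d x‖ₑ ^ 2 = ∫⁻ ξ, ‖m ξ * ((poissonSymbol y ξ : ℂ) * F ξ)‖ₑ ^ 2 := by
  obtain ⟨w, hw1, hw2⟩ := exists_fourier_eq_of_tendsto (g := g) (g₀ := d)
    (G := fun ξ => m ξ * ((poissonSymbol y ξ : ℂ) * F ξ)) (hF.norm.const_mul (C / y))
    (fun k => by
      filter_upwards [hg k] with ξ hξ
      rw [hξ, norm_mul, norm_mul, Complex.norm_real,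
        Real.norm_of_nonneg (poissonSymbol_pos _ ξ).le, ← mul_assoc]
      refine mul_le_mul_of_nonneg_right ?_ (norm_nonneg _)
      set t : ℝ := 2 * Real.pi * ‖ξ‖ with ht
      have ht0 : 0 ≤ t := by positivity
      have h1 : t * poissonSymbol y ξ ≤ 1 / y := by
        rw [poissonSymbol, ← ht, le_div_iff₀ hy, Real.exp_neg, mul_right_comm, ← div_eq_mul_inv,
          div_le_one (Real.exp_pos _)]
        linarith [Real.add_one_le_exp (t * y)]
      calc ‖μ k ξ‖ * poissonSymbol y ξ ≤ (C * t) * poissonSymbol y ξ :=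
            mul_le_mul_of_nonneg_right (hμ k ξ) (poissonSymbol_pos _ ξ).le
        _ = C * (t * poissonSymbol y ξ) := by ring
        _ ≤ C * (1 / y) := by gcongr
        _ = C / y := by ring)
    (by
      filter_upwards [ae_all_iff.2 hg] with ξ hξ
      simp_rw [hξ]
      exact (hm ξ).mul_const _)
    hd
  calc ∫⁻ x, ‖d x‖ₑ ^ 2 = ∫⁻ x, ‖w x‖ₑ ^ 2 := by
        refine lintegral_congr_ae ?_
        filter_upwards [hw1] with x hx
        rw [hx]
    _ = ∫⁻ ξ, ‖(𝓕 w : L2 E) ξ‖ₑ ^ 2 := (lintegral_fourier_sq w).symm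
    _ = _ := by
        refine lintegral_congr_ae ?_
        filter_upwards [hw2] with ξ hξ
        rw [hξ]

lemma tendsto_mul_exp_div_sub_one (z : ℂ) :
    Tendsto (fun k : ℕ => ((k : ℂ) + 1) * (Complex.exp (((k : ℂ) + 1)⁻¹ * z) - 1)) atTop
      (𝓝 z) := by
  have h1 : HasDerivAt (fun s : ℝ => Complex.exp (s * z)) z 0 := by
    have := ((Complex.ofRealCLM.hasDerivAt (x := (0 : ℝ))).mul_const z).cexp
    simpa using this
  have h2 := h1.hasFDerivAt.lim_real 1
  have h3 : Tendsto (fun k : ℕ => (k : ℝ) + 1) atTop atTop :=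
    tendsto_atTop_add_const_right _ _ tendsto_natCast_atTop_atTop
  have h4 := h2.comp h3
  simp only [ContinuousLinearMap.toSpanSingleton_apply, one_smul] at h4
  refine h4.congr fun k => ?_
  simp

end BoundarySpectrum

end HalfSpaceDirichlet

end

noncomputable section

namespace HalfSpaceDirichlet

open scoped SchwartzMap ContDiff FourierTransform LineDeriv Laplacian

section DifferenceQuotients

variable {E : Type*} [NormedAddCommGroup E] [InnerProductSpace ℝ E] [FiniteDimensional ℝ E]
  [MeasurableSpace E] [BorelSpace E]

lemma fourier_smul_sub_ae_eq (c : ℂ) (g w : L2 E) :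
    (𝓕 (c • (g - w)) : L2 E) =ᵐ[volume] fun ξ => c * ((𝓕 g : L2 E) ξ - (𝓕 w : L2 E) ξ) := by
  have h : (𝓕 (c • (g - w)) : L2 E) = c • ((𝓕 g : L2 E) - (𝓕 w : L2 E)) := by
    change Lp.fourierTransformₗᵢ E ℂ _ = _
    rw [map_smul, map_sub]
    rfl
  rw [h]
  filter_upwards [Lp.coeFn_smul c ((𝓕 g : L2 E) - (𝓕 w : L2 E)),
    Lp.coeFn_sub (𝓕 g : L2 E) (𝓕 w : L2 E)] with ξ h1 h2
  rw [h1, Pi.smul_apply, h2, Pi.sub_apply, smul_eq_mul]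

lemma coeFn_smul_sub_ae_eq (c : ℂ) (g w : L2 E) :
    (c • (g - w) : L2 E) =ᵐ[volume] fun x => c * (g x - w x) := by
  filter_upwards [Lp.coeFn_smul c (g - w), Lp.coeFn_sub g w] with ξ h1 h2
  rw [h1, Pi.smul_apply, h2, Pi.sub_apply, smul_eq_mul]

/-- Translation on `L²`. -/
def translate (b : E) (g : L2 E) : L2 E :=
  Lp.compMeasurePreserving (· + b) (measurePreserving_add_right volume b) g

lemma coeFn_translate (b : E) (g : L2 E) : translate b g =ᵐ[volume] fun x => g (x + b) :=
  Lp.coeFn_compMeasurePreserving g _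

lemma lintegral_tangential_derivative {g : L2 E} {F s d : E → ℂ} {y : ℝ} (hF : MemLp F 2 volume)
    (hy : 0 < y) (hg : (𝓕 g : L2 E) =ᵐ[volume] fun ξ => (poissonSymbol y ξ : ℂ) * F ξ)
    (hs : g =ᵐ[volume] s) (a : E)
    (hd : ∀ x, Tendsto (fun k : ℕ => ((k : ℂ) + 1) * (s (x + ((k : ℝ) + 1)⁻¹ • a) - s x)) atTop
      (𝓝 (d x))) :
    ∫⁻ x, ‖d x‖ₑ ^ 2 = ∫⁻ ξ, ‖((2 * Real.pi * inner ℝ ξ a : ℝ) * Complex.I) *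
      ((poissonSymbol y ξ : ℂ) * F ξ)‖ₑ ^ 2 := by
  refine lintegral_sq_of_tendsto_multiplier (C := ‖a‖)
    (g := fun k : ℕ => ((k : ℂ) + 1) • (translate (((k : ℝ) + 1)⁻¹ • a) g - g))
    (μ := fun k ξ => ((k : ℂ) + 1) * (Complex.exp (((k : ℂ) + 1)⁻¹ *
      ((2 * Real.pi * inner ℝ ξ a : ℝ) * Complex.I)) - 1)) hF hy (norm_nonneg _)
    (fun k ξ => ?_) (fun ξ => tendsto_mul_exp_div_sub_one _) (fun k => ?_) ?_
  · have h0 : (0 : ℝ) < (k : ℝ) + 1 := by positivity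
    have e1 : (((k : ℂ) + 1)⁻¹ * ((2 * Real.pi * inner ℝ ξ a : ℝ) * Complex.I)) =
        Complex.I * ((((k : ℝ) + 1)⁻¹ * (2 * Real.pi * inner ℝ ξ a) : ℝ) : ℂ) := by
      push_cast; ring
    have e2 : ‖(k : ℂ) + 1‖ = (k : ℝ) + 1 := by
      rw [← Complex.ofReal_natCast, ← Complex.ofReal_one, ← Complex.ofReal_add,
        Complex.norm_real, Real.norm_of_nonneg h0.le]
    rw [e1, norm_mul, e2]
    calc _ ≤ ((k : ℝ) + 1) * ‖((k : ℝ) + 1)⁻¹ * (2 * Real.pi * inner ℝ ξ a)‖ := by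
          gcongr
          exact Real.norm_exp_I_mul_ofReal_sub_one_le
      _ = 2 * Real.pi * ‖inner ℝ ξ a‖ := by
          rw [norm_mul, norm_mul, Real.norm_of_nonneg (inv_nonneg.2 h0.le),
            Real.norm_of_nonneg Real.two_pi_pos.le]
          field_simp
      _ ≤ 2 * Real.pi * (‖ξ‖ * ‖a‖) := by
          have := norm_inner_le_norm (𝕜 := ℝ) ξ a
          gcongr
      _ = _ := by ring
  · filter_upwards [fourier_smul_sub_ae_eq ((k : ℂ) + 1) (translate (((k : ℝ) + 1)⁻¹ • a) g) g,
      fourier_translate_ae_eq g _ _ (coeFn_translate (((k : ℝ) + 1)⁻¹ • a) g), hg] with ξ h1 h2 h3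
    rw [h1, h2, h3, inner_smul_right]
    have e : (((2 * Real.pi * (((k : ℝ) + 1)⁻¹ * inner ℝ ξ a) : ℝ) : ℂ) * Complex.I) =
        ((k : ℂ) + 1)⁻¹ * ((2 * Real.pi * inner ℝ ξ a : ℝ) * Complex.I) := by
      push_cast; ring
    rw [e]
    ring
  · have hall := ae_all_iff.2 fun k : ℕ =>
      coeFn_smul_sub_ae_eq ((k : ℂ) + 1) (translate (((k : ℝ) + 1)⁻¹ • a) g) g
    have hall2 := ae_all_iff.2 fun k : ℕ => coeFn_translate (((k : ℝ) + 1)⁻¹ • a) g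
    have hall3 := ae_all_iff.2 fun k : ℕ =>
      (measurePreserving_add_right volume (((k : ℝ) + 1)⁻¹ • a)).quasiMeasurePreserving.ae hs
    filter_upwards [hall, hall2, hall3, hs] with x h1 h2 h3 h4
    refine (hd x).congr fun k => ?_
    rw [h1, h2, h3, h4]

lemma lintegral_normal_derivative {U : ℝ → L2 E} {F d : E → ℂ} {y : ℝ} (hF : MemLp F 2 volume)
    (hy : 0 < y)
    (hUF : ∀ y, 0 < y → (𝓕 (U y) : L2 E) =ᵐ[volume] fun ξ => (poissonSymbol y ξ : ℂ) * F ξ)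
    (hd : ∀ᵐ x, Tendsto (fun k : ℕ => ((k : ℂ) + 1) * (U (y + ((k : ℝ) + 1)⁻¹) x - U y x)) atTop
      (𝓝 (d x))) :
    ∫⁻ x, ‖d x‖ₑ ^ 2 = ∫⁻ ξ, ‖((-(2 * Real.pi * ‖ξ‖) : ℝ) : ℂ) *
      ((poissonSymbol y ξ : ℂ) * F ξ)‖ₑ ^ 2 := by
  refine lintegral_sq_of_tendsto_multiplier (C := 1)
    (g := fun k : ℕ => ((k : ℂ) + 1) • (U (y + ((k : ℝ) + 1)⁻¹) - U y))
    (μ := fun k ξ => ((k : ℂ) + 1) * (Complex.exp (((k : ℂ) + 1)⁻¹ *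
      ((-(2 * Real.pi * ‖ξ‖) : ℝ) : ℂ)) - 1)) hF hy zero_le_one
    (fun k ξ => ?_) (fun ξ => tendsto_mul_exp_div_sub_one _) (fun k => ?_) ?_
  · have h0 : (0 : ℝ) < (k : ℝ) + 1 := by positivity
    set t : ℝ := 2 * Real.pi * ‖ξ‖ with ht
    have ht0 : 0 ≤ t := by positivity
    have e1 : ((k : ℂ) + 1) * (Complex.exp (((k : ℂ) + 1)⁻¹ * ((-t : ℝ) : ℂ)) - 1) =
        ((((k : ℝ) + 1) * (Real.exp (-(((k : ℝ) + 1)⁻¹ * t)) - 1) : ℝ) : ℂ) := by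
      push_cast
      rw [mul_neg]
    rw [e1, Complex.norm_real, norm_mul, Real.norm_of_nonneg h0.le, one_mul, norm_sub_rev,
      Real.norm_of_nonneg (sub_nonneg.2 (Real.exp_le_one_iff.2 (neg_nonpos.2 (by positivity))))]
    calc _ ≤ ((k : ℝ) + 1) * (((k : ℝ) + 1)⁻¹ * t) := by
          gcongr
          linarith [Real.add_one_le_exp (-(((k : ℝ) + 1)⁻¹ * t))]
      _ = t := by field_simp
  · have h0 : (0 : ℝ) < ((k : ℝ) + 1)⁻¹ := by positivity
    filter_upwards [fourier_smul_sub_ae_eq ((k : ℂ) + 1) (U (y + ((k : ℝ) + 1)⁻¹)) (U y),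
      hUF y hy, hUF _ (add_pos hy h0)] with ξ h1 h2 h3
    rw [h1, h2, h3]
    have e : (poissonSymbol (y + ((k : ℝ) + 1)⁻¹) ξ : ℂ) =
        Complex.exp (((k : ℂ) + 1)⁻¹ * ((-(2 * Real.pi * ‖ξ‖) : ℝ) : ℂ)) * poissonSymbol y ξ := by
      rw [poissonSymbol, poissonSymbol]
      push_cast
      rw [← Complex.exp_add]
      congr 1
      ring
    rw [e]
    ring
  · filter_upwards [ae_all_iff.2 fun k : ℕ =>
      coeFn_smul_sub_ae_eq ((k : ℂ) + 1) (U (y + ((k : ℝ) + 1)⁻¹)) (U y), hd] with x h1 h2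
    refine h2.congr fun k => ?_
    rw [h1]

end DifferenceQuotients

section DoubleIntegral

variable {n : ℕ}

lemma doubleIntegral_congr {f g : EuclideanSpace ℝ (Fin n) → ℂ} (h : f =ᵐ[volume] g) :
    doubleIntegral f = doubleIntegral g := by
  refine lintegral_congr_ae ?_
  filter_upwards [h] with t₁ h1
  refine lintegral_congr_ae ?_
  filter_upwards [h] with t₂ h2
  rw [h1, h2]

lemma ofReal_norm_sq (z : ℂ) : ENNReal.ofReal (‖z‖ ^ 2) = ‖z‖ₑ ^ 2 := by
  rw [ENNReal.ofReal_pow (norm_nonneg _), ofReal_norm]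

lemma lintegral_translate_sub_sq (w : L2 (EuclideanSpace ℝ (Fin n)))
    (h : EuclideanSpace ℝ (Fin n)) :
    ∫⁻ t, ‖w (t + h) - w t‖ₑ ^ 2 = ∫⁻ ξ, ‖Complex.exp ((2 * Real.pi * inner ℝ ξ h : ℝ) *
      Complex.I) - 1‖ₑ ^ 2 * ‖(𝓕 w : L2 (EuclideanSpace ℝ (Fin n))) ξ‖ₑ ^ 2 := by
  have h1 := lintegral_fourier_sq ((1 : ℂ) • (translate h w - w))
  refine Eq.trans (lintegral_congr_ae ?_) (h1.symm.trans (lintegral_congr_ae ?_))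
  · filter_upwards [coeFn_smul_sub_ae_eq 1 (translate h w) w, coeFn_translate h w] with t e1 e2
    rw [e1, e2, one_mul]
  · filter_upwards [fourier_smul_sub_ae_eq 1 (translate h w) w,
      fourier_translate_ae_eq w _ h (coeFn_translate h w)] with ξ e1 e2
    rw [e1, e2, one_mul, ← mul_pow, ← enorm_mul]
    congr 2
    ring

/-- The double integral in terms of the Fourier transform. -/
theorem doubleIntegral_eq_lintegral_fourier (w : L2 (EuclideanSpace ℝ (Fin n))) :
    doubleIntegral (fun x => w x) = ∫⁻ ξ, ENNReal.ofReal (sphereArea n * (2 * Real.pi * ‖ξ‖)) *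
      ‖(𝓕 w : L2 (EuclideanSpace ℝ (Fin n))) ξ‖ₑ ^ 2 := by
  have hwm : Measurable fun x => w x := (Lp.stronglyMeasurable w).measurable
  have hVm : Measurable fun ξ => (𝓕 w : L2 (EuclideanSpace ℝ (Fin n))) ξ :=
    (Lp.stronglyMeasurable _).measurable
  calc doubleIntegral (fun x => w x)
      = ∫⁻ t, ∫⁻ h, ENNReal.ofReal (‖w t - w (t + h)‖ ^ 2 / ‖t - (t + h)‖ ^ (n + 1)) := by
        refine lintegral_congr fun t => ?_
        exact (lintegral_add_left_eq_self (μ := volume)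
          (fun t₂ => ENNReal.ofReal (‖w t - w t₂‖ ^ 2 / ‖t - t₂‖ ^ (n + 1))) t).symm
    _ = ∫⁻ h, ∫⁻ t, ENNReal.ofReal (‖w t - w (t + h)‖ ^ 2 / ‖t - (t + h)‖ ^ (n + 1)) :=
        lintegral_lintegral_swap (by fun_prop)
    _ = ∫⁻ h : EuclideanSpace ℝ (Fin n), ∫⁻ ξ, ENNReal.ofReal
          (‖Complex.exp ((2 * Real.pi * inner ℝ ξ h : ℝ) * Complex.I) - 1‖ ^ 2 /
            ‖h‖ ^ (n + 1)) * ‖(𝓕 w : L2 (EuclideanSpace ℝ (Fin n))) ξ‖ₑ ^ 2 := by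
        refine lintegral_congr fun h => ?_
        have e1 (a : ℂ) : ENNReal.ofReal (‖a‖ ^ 2 / ‖h‖ ^ (n + 1)) =
            ENNReal.ofReal ((‖h‖ ^ (n + 1))⁻¹) * ‖a‖ₑ ^ 2 := by
          rw [div_eq_inv_mul, ENNReal.ofReal_mul (by positivity), ofReal_norm_sq]
        simp only [sub_add_cancel_left, norm_neg, e1, mul_assoc (ENNReal.ofReal _)]
        rw [lintegral_const_mul' _ _ ENNReal.ofReal_ne_top,
          lintegral_const_mul' _ _ ENNReal.ofReal_ne_top, ← lintegral_translate_sub_sq]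
        congr 1
        refine lintegral_congr fun t => ?_
        rw [← ofReal_norm, ← ofReal_norm, norm_sub_rev]
    _ = ∫⁻ ξ, ∫⁻ h : EuclideanSpace ℝ (Fin n), ENNReal.ofReal
          (‖Complex.exp ((2 * Real.pi * inner ℝ ξ h : ℝ) * Complex.I) - 1‖ ^ 2 /
            ‖h‖ ^ (n + 1)) * ‖(𝓕 w : L2 (EuclideanSpace ℝ (Fin n))) ξ‖ₑ ^ 2 :=
        lintegral_lintegral_swap (by fun_prop)
    _ = _ := by
        refine lintegral_congr fun ξ => ?_
        rw [lintegral_mul_const' _ _ (by finiteness), lintegral_norm_exp_sub_one_sq_div]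

end DoubleIntegral

end HalfSpaceDirichlet

end

noncomputable section

namespace HalfSpaceDirichlet

open scoped SchwartzMap ContDiff FourierTransform LineDeriv Laplacian

section Energy

variable {n : ℕ}

open Classical in
/-- The slice `v(·, y)` as an element of `L²` (zero if it is not square integrable). -/
def slice (v : Ambient n → ℂ) (y : ℝ) : L2 (EuclideanSpace ℝ (Fin n)) :=
  if h : MemLp (fun x => v (pt x y)) 2 volume then h.toLp _ else 0

variable {v : Ambient n → ℂ}

lemma MemHardy.differentiableAt (hv : MemHardy v) {x : EuclideanSpace ℝ (Fin n)} {y : ℝ}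
    (hy : 0 < y) : DifferentiableAt ℝ v (pt x y) :=
  (hv.harmonic _ (pt_mem_upperHalfSpace.2 hy)).1.differentiableAt (by norm_num)

lemma MemHardy.contDiffOn (hv : MemHardy v) : ContDiffOn ℝ 1 v (upperHalfSpace n) := fun p hp =>
  ((hv.harmonic p hp).1.of_le (by norm_num)).contDiffWithinAt

lemma MemHardy.memLp_slice (hv : MemHardy v) {y : ℝ} (hy : 0 < y) :
    MemLp (fun x => v (pt x y)) 2 volume := by
  refine ⟨(continuous_iff_continuousAt.2 fun x =>
    (fderiv_slice (hv.differentiableAt hy)).1.continuousAt).aestronglyMeasurable, ?_⟩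
  exact (le_iSup₂ (f := fun y (_ : y ∈ Ioi (0 : ℝ)) =>
    eLpNorm (fun x : EuclideanSpace ℝ (Fin n) => v (pt x y)) 2 volume) y hy).trans_lt
      hv.norm_lt_top

lemma MemHardy.coeFn_slice (hv : MemHardy v) {y : ℝ} (hy : 0 < y) :
    slice v y =ᵐ[volume] fun x => v (pt x y) := by
  rw [slice, dif_pos (hv.memLp_slice hy)]
  exact MemLp.coeFn_toLp _

lemma MemHardy.norm_slice_le (hv : MemHardy v) {y : ℝ} (hy : 0 < y) :
    ‖slice v y‖ ≤ (hardyNorm v).toReal := by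
  rw [slice, dif_pos (hv.memLp_slice hy), Lp.norm_toLp]
  exact ENNReal.toReal_mono hv.norm_lt_top.ne
    (le_iSup₂ (f := fun y (_ : y ∈ Ioi (0 : ℝ)) =>
      eLpNorm (fun x : EuclideanSpace ℝ (Fin n) => v (pt x y)) 2 volume) y hy)

lemma MemHardy.integral_mul_slice (hv : MemHardy v) {y : ℝ} (hy : 0 < y)
    (φ : EuclideanSpace ℝ (Fin n) → ℂ) :
    ∫ x, φ x * slice v y x = ∫ x, v (pt x y) * φ x := by
  refine integral_congr_ae ?_
  filter_upwards [hv.coeFn_slice hy] with x hx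
  rw [hx, mul_comm]

lemma MemHardy.isHarmonicFamily (hv : MemHardy v) :
    IsHarmonicFamily (slice v) (hardyNorm v).toReal where
  norm_le y hy := hv.norm_slice_le hy
  hasDerivAt φ hφ := by
    refine ⟨fun y => ∫ x, fderiv ℝ v (pt x y) (pt 0 1) * φ x, fun y hy => ⟨?_, ?_⟩⟩
    · refine (hasDerivAt_integral_slice_mul hv.contDiffOn φ.continuous hφ hy).congr_of_eventuallyEq
        ?_
      filter_upwards [Ioi_mem_nhds hy] with z hz
      exact hv.integral_mul_slice hz φ
    · rw [hv.integral_mul_slice hy]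
      exact hasDerivAt_integral_deriv_slice hv.harmonic φ hφ hy

lemma tendsto_natCast_mul_sub {E : Type*} [NormedAddCommGroup E] [NormedSpace ℝ E] {s : E → ℂ}
    {x : E} (hs : DifferentiableAt ℝ s x) (a : E) :
    Tendsto (fun k : ℕ => ((k : ℂ) + 1) * (s (x + ((k : ℝ) + 1)⁻¹ • a) - s x)) atTop
      (𝓝 (fderiv ℝ s x a)) := by
  have h1 : Tendsto (fun k : ℕ => ‖(k : ℝ) + 1‖) atTop atTop :=
    tendsto_norm_atTop_atTop.comp (tendsto_atTop_add_const_right _ _ tendsto_natCast_atTop_atTop)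
  have h2 := hs.hasFDerivAt.lim_real a
  have h3 : Tendsto (fun k : ℕ => (k : ℝ) + 1) atTop atTop :=
    tendsto_atTop_add_const_right _ _ tendsto_natCast_atTop_atTop
  refine (h2.comp h3).congr fun k => ?_
  simp [Function.comp]

lemma sum_inner_single_sq (ξ : EuclideanSpace ℝ (Fin n)) :
    ∑ j, (inner ℝ ξ (EuclideanSpace.single j (1 : ℝ))) ^ 2 = ‖ξ‖ ^ 2 := by
  simp [EuclideanSpace.norm_sq_eq, EuclideanSpace.inner_single_right]

lemma lintegral_gradNormSq_slice (hv : MemHardy v) {F : EuclideanSpace ℝ (Fin n) → ℂ}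
    (hF : MemLp F 2 volume) (hFm : Measurable F)
    (hUF : ∀ y, 0 < y → (𝓕 (slice v y) : L2 (EuclideanSpace ℝ (Fin n))) =ᵐ[volume]
      fun ξ => (poissonSymbol y ξ : ℂ) * F ξ) {y : ℝ} (hy : 0 < y) :
    ∫⁻ x, ENNReal.ofReal (gradNormSq v (pt x y)) = ∫⁻ ξ, ENNReal.ofReal
      (2 * (2 * Real.pi * ‖ξ‖) ^ 2 * Real.exp (-(2 * (2 * Real.pi * ‖ξ‖) * y))) * ‖F ξ‖ₑ ^ 2 := by
  have hm (b : Ambient n) : Measurable fun x : EuclideanSpace ℝ (Fin n) =>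
      fderiv ℝ v (pt x y) b :=
    (measurable_fderiv_apply_const ℝ v b).comp
      (continuous_pt.comp (Continuous.prodMk_left y)).measurable
  have htan (j : Fin n) := lintegral_tangential_derivative hF hy (hUF y hy) (hv.coeFn_slice hy)
    (EuclideanSpace.single j (1 : ℝ))
    (d := fun x => fderiv ℝ v (pt x y) (pt (EuclideanSpace.single j 1) 0)) fun x => by
      have h := fderiv_slice (hv.differentiableAt (x := x) hy)
      rw [← h.2]
      exact tendsto_natCast_mul_sub h.1 _
  have hnor := lintegral_normal_derivative hF hy hUF
    (d := fun x => fderiv ℝ v (pt x y) (pt 0 1)) (by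
      have h0 (k : ℕ) : 0 < y + ((k : ℝ) + 1)⁻¹ := by positivity
      filter_upwards [ae_all_iff.2 fun k : ℕ => hv.coeFn_slice (h0 k), hv.coeFn_slice hy]
        with x h1 h2
      have h := hasDerivAt_slice (hv.differentiableAt (x := x) hy)
      have h3 := tendsto_natCast_mul_sub h.differentiableAt (1 : ℝ)
      rw [h.hasFDerivAt.fderiv] at h3
      simp only [ContinuousLinearMap.toSpanSingleton_apply, one_smul, smul_eq_mul, mul_one] at h3
      refine h3.congr fun k => ?_
      rw [h1, h2])
  have hgrad (x : EuclideanSpace ℝ (Fin n)) : ENNReal.ofReal (gradNormSq v (pt x y)) =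
      ∑ j : Fin n, ‖fderiv ℝ v (pt x y) (pt (EuclideanSpace.single j 1) 0)‖ₑ ^ 2 +
        ‖fderiv ℝ v (pt x y) (pt 0 1)‖ₑ ^ 2 := by
    rw [gradNormSq, ENNReal.ofReal_add (Finset.sum_nonneg fun _ _ => sq_nonneg _) (sq_nonneg _),
      ENNReal.ofReal_sum_of_nonneg fun _ _ => sq_nonneg _]
    simp only [ofReal_norm_sq]
  simp only [hgrad]
  rw [lintegral_add_right _ ((hm _).enorm.pow_const 2),
    lintegral_finsetSum _ fun j _ => (hm _).enorm.pow_const 2]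
  simp only [htan, hnor]
  have hpm : Measurable fun ξ : EuclideanSpace ℝ (Fin n) => (poissonSymbol y ξ : ℂ) := by
    unfold poissonSymbol
    fun_prop
  rw [← lintegral_finsetSum _ fun j _ => by fun_prop, ← lintegral_add_right _ (by fun_prop)]
  refine lintegral_congr fun ξ => ?_
  have e (z : ℂ) : ‖z * ((poissonSymbol y ξ : ℂ) * F ξ)‖ₑ ^ 2 =
      ENNReal.ofReal (‖z‖ ^ 2 * poissonSymbol y ξ ^ 2) * ‖F ξ‖ₑ ^ 2 := by
    rw [← ofReal_norm_sq, ← ofReal_norm_sq, ← ENNReal.ofReal_mul (by positivity), norm_mul,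
      norm_mul, Complex.norm_real, Real.norm_of_nonneg (poissonSymbol_pos _ _).le]
    ring_nf
  simp only [e]
  rw [← Finset.sum_mul, ← add_mul, ← ENNReal.ofReal_sum_of_nonneg fun _ _ => by positivity,
    ← ENNReal.ofReal_add (Finset.sum_nonneg fun _ _ => by positivity) (by positivity),
    ← Finset.sum_mul, ← add_mul]
  congr 2
  have e2 : poissonSymbol y ξ ^ 2 = Real.exp (-(2 * (2 * Real.pi * ‖ξ‖) * y)) := by
    rw [poissonSymbol, ← Real.exp_nat_mul]
    congr 1
    push_cast
    ring
  have e3 : ∑ j : Fin n, ‖((2 * Real.pi * inner ℝ ξ (EuclideanSpace.single j (1 : ℝ)) : ℝ) : ℂ) *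
      Complex.I‖ ^ 2 = (2 * Real.pi * ‖ξ‖) ^ 2 := by
    rw [mul_pow, ← sum_inner_single_sq, Finset.mul_sum]
    refine Finset.sum_congr rfl fun j _ => ?_
    rw [norm_mul, Complex.norm_I, mul_one, Complex.norm_real, Real.norm_eq_abs, sq_abs, mul_pow]
  rw [e2, e3, Complex.norm_real, Real.norm_eq_abs, sq_abs]
  ring

lemma lintegral_upperHalfSpace {g : Ambient n → ℝ≥0∞} (hg : Measurable g) :
    ∫⁻ p in upperHalfSpace n, g p = ∫⁻ y in Ioi (0 : ℝ), ∫⁻ x, g (pt x y) := by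
  have hmp := WithLp.volume_preserving_toLp (EuclideanSpace ℝ (Fin n)) ℝ
  rw [← hmp.setLIntegral_comp_preimage isOpen_upperHalfSpace.measurableSet hg]
  have hpre : WithLp.toLp 2 ⁻¹' (upperHalfSpace n) =
      (univ : Set (EuclideanSpace ℝ (Fin n))) ×ˢ Ioi (0 : ℝ) := by
    ext p
    simp [upperHalfSpace]
  rw [hpre, Measure.volume_eq_prod, ← Measure.prod_restrict, Measure.restrict_univ]
  exact lintegral_prod_symm _ (hg.comp continuous_pt.measurable).aemeasurable

lemma lintegral_sq_mul_exp (t : ℝ) (ht : 0 ≤ t) :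
    ∫⁻ y in Ioi (0 : ℝ), ENNReal.ofReal (2 * t ^ 2 * Real.exp (-(2 * t * y))) =
      ENNReal.ofReal t := by
  rcases ht.eq_or_lt with rfl | ht
  · simp
  have h := lintegral_rpow_mul_exp_neg_mul (a := 1) (r := 2 * t) one_pos (by positivity)
  simp only [sub_self, Real.rpow_zero, one_mul, Real.rpow_one, Real.Gamma_one, mul_one] at h
  have e (y : ℝ) : ENNReal.ofReal (2 * t ^ 2 * Real.exp (-(2 * t * y))) =
      ENNReal.ofReal (2 * t ^ 2) * ENNReal.ofReal (Real.exp (-(2 * t * y))) :=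
    ENNReal.ofReal_mul (by positivity)
  simp only [e]
  rw [lintegral_const_mul' _ _ ENNReal.ofReal_ne_top, h, ← ENNReal.ofReal_mul (by positivity)]
  congr 1
  field_simp

lemma measurable_gradNormSq (v : Ambient n → ℂ) : Measurable (gradNormSq v) := by
  unfold gradNormSq
  have hm (b : Ambient n) : Measurable fun p => fderiv ℝ v p b :=
    measurable_fderiv_apply_const ℝ v b
  fun_prop

/-- The Dirichlet energy in terms of the boundary spectrum. -/
theorem dirichletEnergy_eq_lintegral (hv : MemHardy v) {F : EuclideanSpace ℝ (Fin n) → ℂ}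
    (hF : MemLp F 2 volume) (hFm : Measurable F)
    (hUF : ∀ y, 0 < y → (𝓕 (slice v y) : L2 (EuclideanSpace ℝ (Fin n))) =ᵐ[volume]
      fun ξ => (poissonSymbol y ξ : ℂ) * F ξ) :
    dirichletEnergy v = ∫⁻ ξ, ENNReal.ofReal (2 * Real.pi * ‖ξ‖) * ‖F ξ‖ₑ ^ 2 := by
  rw [dirichletEnergy, lintegral_upperHalfSpace (measurable_gradNormSq v).ennreal_ofReal]
  rw [setLIntegral_congr_fun measurableSet_Ioi fun y hy =>
    lintegral_gradNormSq_slice hv hF hFm hUF hy]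
  rw [lintegral_lintegral_swap (by fun_prop)]
  refine lintegral_congr fun ξ => ?_
  rw [lintegral_mul_const' _ _ (by finiteness), lintegral_sq_mul_exp _ (by positivity)]

end Energy

end HalfSpaceDirichlet

end

noncomputable section

namespace HalfSpaceDirichlet

open scoped SchwartzMap ContDiff FourierTransform LineDeriv Laplacian

section Identity

variable {n : ℕ}

lemma sphereArea_pos (n : ℕ) : 0 < sphereArea n := by
  have := Real.Gamma_pos_of_pos (s := ((n : ℝ) + 1) / 2) (by positivity)
  have := Real.pi_pos
  unfold sphereArea
  positivity

/-- The energy identity for complex-valued functions. -/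
theorem dirichletEnergy_eq_doubleIntegral (hn : 1 ≤ n) {v : Ambient n → ℂ}
    {f : EuclideanSpace ℝ (Fin n) → ℂ} (hv : MemHardy v) (hf : IsBoundaryFunction v f) :
    dirichletEnergy v = ENNReal.ofReal (1 / sphereArea n) * doubleIntegral f := by
  have : Nonempty (Fin n) := ⟨⟨0, hn⟩⟩
  obtain ⟨F₀, hF₀, hUF₀⟩ := exists_boundary_spectrum hv.isHarmonicFamily
  obtain ⟨F, hFm, hFF₀⟩ : ∃ F, Measurable F ∧ F₀ =ᵐ[volume] F :=
    ⟨hF₀.1.mk F₀, hF₀.1.stronglyMeasurable_mk.measurable, hF₀.1.ae_eq_mk⟩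
  have hF : MemLp F 2 volume := (memLp_congr_ae hFF₀).1 hF₀
  have hUF (y : ℝ) (hy : 0 < y) : (𝓕 (slice v y) : L2 (EuclideanSpace ℝ (Fin n))) =ᵐ[volume]
      fun ξ => (poissonSymbol y ξ : ℂ) * F ξ := by
    filter_upwards [hUF₀ y hy, hFF₀] with ξ h1 h2
    rw [h1, h2]
  have hpos (k : ℕ) : (0 : ℝ) < 1 / ((k : ℝ) + 1) := by positivity
  have hseq : Tendsto (fun k : ℕ => 1 / ((k : ℝ) + 1)) atTop (𝓝[>] 0) :=
    tendsto_nhdsWithin_iff.2 ⟨tendsto_one_div_add_atTop_nhds_zero_nat, Eventually.of_forall hpos⟩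
  obtain ⟨w, hwf, hwF⟩ := exists_fourier_boundary hF hUF (f := f) (by
    filter_upwards [hf, ae_all_iff.2 fun k : ℕ => hv.coeFn_slice (hpos k)] with x h1 h2
    refine (h1.comp hseq).congr fun k => ?_
    rw [h2, Function.comp])
  rw [dirichletEnergy_eq_lintegral hv hF hFm hUF, ← doubleIntegral_congr hwf,
    doubleIntegral_eq_lintegral_fourier, ← lintegral_const_mul' _ _ ENNReal.ofReal_ne_top]
  refine lintegral_congr_ae ?_
  filter_upwards [hwF] with ξ hξ
  have := sphereArea_pos n
  rw [hξ, ← mul_assoc, ← ENNReal.ofReal_mul (by positivity)]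
  congr 2
  field_simp

end Identity

section Complexification

variable {𝕜 : Type*} [RCLike 𝕜] {n : ℕ}

/-- The isometric embedding of `ℝ` or `ℂ` into `ℂ`. -/
def toComplex (𝕜 : Type*) [RCLike 𝕜] : 𝕜 →ₗᵢ[ℝ] ℂ where
  toFun z := ⟨RCLike.re z, RCLike.im z⟩
  map_add' z w := by apply Complex.ext <;> simp
  map_smul' c z := by apply Complex.ext <;> simp [RCLike.smul_re, RCLike.smul_im]
  norm_map' z := by
    rw [← sq_eq_sq₀ (norm_nonneg _) (norm_nonneg _), RCLike.norm_sq_eq_def (z := z),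
      Complex.sq_norm, Complex.normSq_apply]
    simp

lemma fderiv_toComplex {G : Type*} [NormedAddCommGroup G] [NormedSpace ℝ G] {u : G → 𝕜} {p : G}
    (hu : DifferentiableAt ℝ u p) (b : G) :
    fderiv ℝ (fun p => toComplex 𝕜 (u p)) p b = toComplex 𝕜 (fderiv ℝ u p b) := by
  have h1 : HasFDerivAt (toComplex 𝕜) (toComplex 𝕜).toContinuousLinearMap (u p) :=
    (toComplex 𝕜).toContinuousLinearMap.hasFDerivAt
  have h2 : HasFDerivAt (fun p => toComplex 𝕜 (u p))
      ((toComplex 𝕜).toContinuousLinearMap ∘L fderiv ℝ u p) p := h1.comp p hu.hasFDerivAt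
  exact DFunLike.congr_fun h2.fderiv b

lemma gradNormSq_toComplex {u : Ambient n → 𝕜} {p : Ambient n} (hu : DifferentiableAt ℝ u p) :
    gradNormSq (fun p => toComplex 𝕜 (u p)) p = gradNormSq u p := by
  simp only [gradNormSq, fderiv_toComplex hu, LinearIsometry.norm_map]

lemma hardyNorm_toComplex (u : Ambient n → 𝕜) :
    hardyNorm (fun p => toComplex 𝕜 (u p)) = hardyNorm u := by
  unfold hardyNorm
  refine iSup_congr fun y => iSup_congr fun _ => eLpNorm_congr_norm_ae (Eventually.of_forall fun x => ?_)
  exact (toComplex 𝕜).norm_map _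

lemma MemHardy.toComplex {u : Ambient n → 𝕜} (hu : MemHardy u) :
    MemHardy (fun p => toComplex 𝕜 (u p)) where
  harmonic := hu.harmonic.comp_CLM (HalfSpaceDirichlet.toComplex 𝕜).toContinuousLinearMap
  norm_lt_top := by
    rw [hardyNorm_toComplex]
    exact hu.norm_lt_top

lemma dirichletEnergy_toComplex {u : Ambient n → 𝕜} (hu : MemHardy u) :
    dirichletEnergy (fun p => toComplex 𝕜 (u p)) = dirichletEnergy u :=
  setLIntegral_congr_fun isOpen_upperHalfSpace.measurableSet fun p hp =>
    congrArg ENNReal.ofReal (gradNormSq_toComplex ((hu.harmonic p hp).1.differentiableAt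
      (by norm_num)))

lemma doubleIntegral_toComplex (f : EuclideanSpace ℝ (Fin n) → 𝕜) :
    doubleIntegral (fun x => toComplex 𝕜 (f x)) = doubleIntegral f := by
  unfold doubleIntegral
  simp only [← map_sub, LinearIsometry.norm_map]

lemma IsBoundaryFunction.toComplex {u : Ambient n → 𝕜} {f : EuclideanSpace ℝ (Fin n) → 𝕜}
    (hf : IsBoundaryFunction u f) :
    IsBoundaryFunction (fun p => toComplex 𝕜 (u p)) (fun x => toComplex 𝕜 (f x)) := by
  filter_upwards [hf] with x hx
  exact ((HalfSpaceDirichlet.toComplex 𝕜).continuous.tendsto _).comp hx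

end Complexification

end HalfSpaceDirichlet

end

theorem mainTheorem2 {𝕜 : Type*} [RCLike 𝕜] (n : ℕ) (hn : 1 ≤ n)
    (u : HalfSpaceDirichlet.Ambient n → 𝕜) (f : EuclideanSpace ℝ (Fin n) → 𝕜)
    (hu : HalfSpaceDirichlet.MemDirichlet u)
    (hf : HalfSpaceDirichlet.IsBoundaryFunction u f) :
    HalfSpaceDirichlet.dirichletEnergy u =
      ENNReal.ofReal (1 / HalfSpaceDirichlet.sphereArea n) *
        HalfSpaceDirichlet.doubleIntegral f := by
  rw [← HalfSpaceDirichlet.dirichletEnergy_toComplex hu.memHardy,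
    ← HalfSpaceDirichlet.doubleIntegral_toComplex]
  exact HalfSpaceDirichlet.dirichletEnergy_eq_doubleIntegral hn hu.memHardy.toComplex hf.toComplex
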